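/- **Cosmic no-hair theorem for Bianchi models in the conformal frame of $R+\alpha R^2$ gravity.** Setting. Let $\alpha>0$, $$V(\varphi)=\frac1{8\alpha}\Bigl[1-e^{-\sqrt{2/3}\,\varphi}\Bigr]^2,\qquad V_\infty:=\lim_{\varphi\to+\infty}V(\varphi)=\frac1{8\alpha}.$$ A *Bianchi model* consists of a three-dimensional real Lie algebra $\mathfrak g$ with basis $e_1,e_2,e_3$, an open time interval $J$, a $C^2$ spatially homogeneous metric $-dt^2+h_{ij}(t)\,\omega^i\omega^j$ ($t\in J$, $h(t)$ positive definite, $\omega^i$ the left-invariant coframe dual to $e_i$), a $C^2$ scalar field $\phi(t)$, and a perfect fluid comoving with $n=\partial_t$, with energy density $\rho(t)$ and pressure $p(t)$, such that on $J$ $$G_{ab}=T^{\phi}_{ab}+T_{ab},\qquad \Box\phi-V'(\phi)=0,$$ $$T^\phi_{ab}=\partial_a\phi\,\partial_b\phi-g_{ab}\bigl(\tfrac12(\partial\phi)^2+V(\phi)\bigr),\qquad T_{ab}=(\rho+p)n_an_b+p\,g_{ab},$$ and the strong and dominant energy conditions $\rho+3p\ge0$, $|p|\le\rho$ hold. The model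 has type IX if $\mathfrak g\cong\mathfrak{so}(3)$. Let $K_{ij}=\frac12\dot h_{ij}$ be the extrinsic curvature of the slices, $K$ its trace, $\sigma_{ij}=K_{ij}-\frac13Kh_{ij}$, $\sigma^2=\frac12\sigma_{ij}\sigma^{ij}$, ${}^{(3)}R$ the scalar curvature of the slices, and ${}^{(3)}R_{\max}(t)$ the supremum of the scalar curvatures of the left-invariant metrics on the same Lie algebra with the same determinant (in the basis $e_i$) as $h(t)$. Put $$E=\tfrac12\dot\phi^2+V(\phi),\quad S=\tfrac13K^2-E,\quad m=\sqrt{\eta V_\infty/3},\quad \lambda=\sqrt{\tfrac23\eta V_\infty}.$$ Let $t_i\in J$, $K(t_i)>0$ (initially expanding), $\phi(t_i)>0$. For $\eta\in(0,1)$, a time $t\in J$, $t>t_i$, is *in the inflationary regime* if $V(\phi(s))\ge\eta V_\infty$ for all $s\in[t_i,t]$. Write $\tau=t-t_i$ and $$T_0=\int_{\phi(t)}^{\phi(t_i)}\frac{dy}{\sqrt{\dot\phi(t_i)^2+2\bigl(V(\phi(t_i))-V(y)\bigr)}},$$ which, when $\phi(t)\le\phi(t_i)$, is the time of descent under $\ddot\phi+V'(\phi)=0$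 from $\phi(t_i)$ to $\phi(t)$ with initial speed $|\dot\phi(t_i)|$. **(1)** Let the model be of any Bianchi type except IX, and $0<\eta<1$. Then for every $t$ in the inflationary regime $$0\le S(t)\le\frac{3m^2}{\sinh^2(m\tau)},\qquad \sigma^2,\rho\ge0,\quad {}^{(3)}R\le0,\qquad \sigma^2+\rho+\tfrac12|{}^{(3)}R|\le\frac{3m^2}{\sinh^2(m\tau)},$$ $$\sqrt{3\eta V_\infty}\le K(t)\le\sqrt{3V_\infty}\,\coth\bigl(\sqrt{V_\infty/3}\,\tau\bigr),\qquad \tau\ge T_0,$$ and if $\tau\ge 1/\sqrt{V_\infty}$ (one Hubble time), then $\sigma^2+\rho+\tfrac12|{}^{(3)}R|\le 9V_\infty e^{-2m\tau}$. **(2)** Let the model be of type IX, $\frac49\le\eta<1$, and $V(\phi(t_i))>{}^{(3)}R_{\max}(t_i)$. Then for every $t$ in the inflationary regime $$-\tfrac12{}^{(3)}R_{\max}(t_i)\,e^{-\lambda\tau}\le S(t)\le\max\Bigl\{0,\frac{3m^2}{\sinh^2(m\tau)}\Bigr\},$$ $$-2S\le{}^{(3)}R\le{}^{(3)}R_{\max}(t)\le{}^{(3)}R_{\max}(t_i)e^{-\lambda\tau},\qquad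 \sigma^2,\rho\ge0,$$ $$\sigma^2+\rho+\tfrac12|{}^{(3)}R|\le\frac{3m^2}{\sinh^2(m\tau)}+{}^{(3)}R_{\max}(t_i)e^{-\lambda\tau},$$ $$K(t)>0,\quad K(t)^2\ge3\eta V_\infty-\tfrac32{}^{(3)}R_{\max}(t_i)e^{-\lambda\tau},\quad K(t)\le\sqrt{3V_\infty}\,\coth\bigl(\sqrt{V_\infty/3}\,\tau\bigr),\quad \tau\ge T_0,$$ and if $\tau\ge1/\sqrt{V_\infty}$, then $\sigma^2+\rho+\tfrac12|{}^{(3)}R|\le10V_\infty e^{-\lambda\tau}$. **(3)** The inflationary regime lasts long enough for complete isotropization, and exceeds any prescribed number (for example $65$) of times $1/\sqrt{V_\infty}$ if the model starts far enough on the plateau: for every $\varepsilon>0$ there is $T>0$ such that for all $\eta\in(0,1)$, $v\ge0$, $N>0$ there is $\phi_0$ such that the following holds for all $\alpha>0$ and all Bianchi models with $K(t_i)>0$, $\phi(t_i)\ge\phi_0$, $\dot\phi(t_i)\ge-v\sqrt{V_\infty}$, and, in type IX, $V(\phi(t_i))>{}^{(3)}R_{\max}(t_i)$. For every $t\in J$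 with $t_i\le t\le t_i+N/\sqrt{V_\infty}$, $$V(\phi(t))\ge\eta V_\infty,\qquad\text{and}\qquad \sigma^2+\rho+\tfrac12|{}^{(3)}R|\le\varepsilon V_\infty\ \text{ at } t \text{ if } t\ge t_i+T/\sqrt{V_\infty}.$$ -/

import Mathlib

open Real Set Filter Topology

noncomputable section

namespace BianchiCosmology

/-! ### Curvature in a frame

A frame `e_a` (`a : ι`) with constant structure coefficients `[e_a, e_b] = c^k_{ab} e_k`, written
`c k a b`, on a space on which all scalar functions depend on one parameter `t` only, so that
`e_a f = δ a * f'`.  The metric has frame components `g t a b`. -/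

section Frame

variable {ι : Type} [Fintype ι] [DecidableEq ι]

/-- Connection coefficients `Γ^d_{ab}` of the Levi-Civita connection, `∇_{e_a} e_b = Γ^d_{ab} e_d`,
given by the Koszul formula. -/
def connection (c : ι → ι → ι → ℝ) (δ : ι → ℝ) (g : ℝ → Matrix ι ι ℝ) (d a b : ι) (t : ℝ) : ℝ :=
  ∑ f, (g t)⁻¹ d f * (1 / 2) *
    (δ a * deriv (fun s => g s b f) t + δ b * deriv (fun s => g s a f) t
      - δ f * deriv (fun s => g s a b) t
      + ∑ k, (c k a b * g t k f - c k a f * g t k b - c k b f * g t k a))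

/-- Curvature components `R^d_{cab}`, where
`R(e_a, e_b) e_c = ∇_a ∇_b e_c - ∇_b ∇_a e_c - ∇_{[e_a, e_b]} e_c = R^d_{cab} e_d`. -/
def riemann (C : ι → ι → ι → ℝ) (δ : ι → ℝ) (g : ℝ → Matrix ι ι ℝ) (d c a b : ι) (t : ℝ) : ℝ :=
  δ a * deriv (fun s => connection C δ g d b c s) t
    - δ b * deriv (fun s => connection C δ g d a c s) t
    + ∑ k, (connection C δ g d a k t * connection C δ g k b c t
        - connection C δ g d b k t * connection C δ g k a c t
        - C k a b * connection C δ g d k c t)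

/-- Ricci tensor `R_{cb} = R^a_{cab}`. -/
def ricci (C : ι → ι → ι → ℝ) (δ : ι → ℝ) (g : ℝ → Matrix ι ι ℝ) (c b : ι) (t : ℝ) : ℝ :=
  ∑ a, riemann C δ g a c a b t

/-- Scalar curvature. -/
def scalarCurvature (C : ι → ι → ι → ℝ) (δ : ι → ℝ) (g : ℝ → Matrix ι ι ℝ) (t : ℝ) : ℝ :=
  ∑ a, ∑ b, (g t)⁻¹ a b * ricci C δ g a b t

/-- Einstein tensor `G_{ab} = R_{ab} - (1/2) R g_{ab}`. -/
def einstein (C : ι → ι → ι → ℝ) (δ : ι → ℝ) (g : ℝ → Matrix ι ι ℝ) (a b : ι) (t : ℝ) : ℝ :=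
  ricci C δ g a b t - 1 / 2 * scalarCurvature C δ g t * g t a b

/-- The wave operator `g^{ab} ∇_a ∇_b φ` on a function of `t`. -/
def waveOp (C : ι → ι → ι → ℝ) (δ : ι → ℝ) (g : ℝ → Matrix ι ι ℝ) (φ : ℝ → ℝ) (t : ℝ) : ℝ :=
  ∑ a, ∑ b, (g t)⁻¹ a b * (δ a * δ b * deriv (deriv φ) t
    - ∑ k, connection C δ g k a b t * (δ k * deriv φ t))

end Frame

/-! ### Homogeneous three-geometries -/

section Spatial

variable {𝔤 : Type*} [LieRing 𝔤] [LieAlgebra ℝ 𝔤]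

/-- Structure constants `C^k_{ij}` of a three-dimensional Lie algebra in a basis. -/
def structureConst (e : Module.Basis (Fin 3) ℝ 𝔤) (k i j : Fin 3) : ℝ := e.repr ⁅e i, e j⁆ k

/-- Scalar curvature of the left-invariant metric with components `h` in the basis `e`. -/
def spatialCurvature (e : Module.Basis (Fin 3) ℝ 𝔤) (h : Matrix (Fin 3) (Fin 3) ℝ) : ℝ :=
  scalarCurvature (structureConst e) 0 (fun _ => h) 0

/-- The largest scalar curvature of a left-invariant metric with the same determinant as `h`. -/
def spatialCurvatureMax (e : Module.Basis (Fin 3) ℝ 𝔤) (h : Matrix (Fin 3) (Fin 3) ℝ) : ℝ :=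
  sSup {r | ∃ k : Matrix (Fin 3) (Fin 3) ℝ, k.PosDef ∧ k.det = h.det ∧ r = spatialCurvature e k}

/-- Bianchi type IX: the Lie algebra of the homogeneity group is `so(3)`, that is, `su(2)`. -/
def IsTypeIX (𝔤 : Type*) [LieRing 𝔤] [LieAlgebra ℝ 𝔤] : Prop :=
  Nonempty (𝔤 ≃ₗ⁅ℝ⁆ LieAlgebra.Orthogonal.so (Fin 3) ℝ)

end Spatial

/-! ### The spacetime: frame `n = ∂_t` (index `inl ()`) and invariant `e_i` (index `inr i`),
with metric `-dt² + h_{ij}(t) ω^i ω^j`. -/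

/-- Structure coefficients of the spacetime frame: `[n, e_i] = 0`, `[e_i, e_j] = C^k_{ij} e_k`. -/
def spacetimeStructure (C : Fin 3 → Fin 3 → Fin 3 → ℝ) :
    Unit ⊕ Fin 3 → Unit ⊕ Fin 3 → Unit ⊕ Fin 3 → ℝ
  | .inr k, .inr i, .inr j => C k i j
  | _, _, _ => 0

/-- `n f = f'` and `e_i f = 0` for functions of `t`. -/
def timeDirection : Unit ⊕ Fin 3 → ℝ := Sum.elim (fun _ => 1) (fun _ => 0)

/-- Spacetime metric. -/
def spacetimeMetric (h : ℝ → Matrix (Fin 3) (Fin 3) ℝ) (t : ℝ) :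
    Matrix (Unit ⊕ Fin 3) (Unit ⊕ Fin 3) ℝ :=
  Matrix.fromBlocks (-1) 0 0 (h t)

/-- Extrinsic curvature `K_{ij} = ∇_i n_j = h'_{ij} / 2` of the slices. -/
def extrinsic (h : ℝ → Matrix (Fin 3) (Fin 3) ℝ) (t : ℝ) : Matrix (Fin 3) (Fin 3) ℝ :=
  Matrix.of fun i j => deriv (fun s => h s i j) t / 2

/-- Expansion `K = h^{ij} K_{ij}`. -/
def expansion (h : ℝ → Matrix (Fin 3) (Fin 3) ℝ) (t : ℝ) : ℝ :=
  ((h t)⁻¹ * extrinsic h t).trace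

/-- Shear `σ_{ij} = K_{ij} - (1/3) K h_{ij}`. -/
def shear (h : ℝ → Matrix (Fin 3) (Fin 3) ℝ) (t : ℝ) : Matrix (Fin 3) (Fin 3) ℝ :=
  extrinsic h t - (expansion h t / 3) • h t

/-- `σ² = (1/2) σ_{ij} σ^{ij}`. -/
def shearSq (h : ℝ → Matrix (Fin 3) (Fin 3) ℝ) (t : ℝ) : ℝ :=
  1 / 2 * ((h t)⁻¹ * shear h t * ((h t)⁻¹ * shear h t)).trace

/-! ### Matter -/

/-- The potential of quadratic gravity. -/
def potential (α φ : ℝ) : ℝ := 1 / (8 * α) * (1 - exp (-√(2 / 3) * φ)) ^ 2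

/-- The height `V_∞` of the plateau. -/
def Vinf (α : ℝ) : ℝ := 1 / (8 * α)

theorem tendsto_potential (α : ℝ) : Tendsto (potential α) atTop (𝓝 (Vinf α)) := by
  have h1 : Tendsto (fun φ : ℝ => √(2 / 3) * φ) atTop atTop :=
    tendsto_id.const_mul_atTop (by positivity)
  have h2 : Tendsto (fun φ : ℝ => exp (-√(2 / 3) * φ)) atTop (𝓝 0) := by
    simpa [Function.comp_def] using tendsto_exp_neg_atTop_nhds_zero.comp h1
  have h3 := ((h2.const_sub 1).pow 2).const_mul (1 / (8 * α))
  rw [sub_zero, one_pow, mul_one] at h3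
  exact h3

/-- Energy-momentum tensor of the scalar field,
`∂_a φ ∂_b φ - g_{ab} ((1/2) g^{cd} ∂_c φ ∂_d φ + V(φ))`. -/
def scalarStress (α : ℝ) (h : ℝ → Matrix (Fin 3) (Fin 3) ℝ) (φ : ℝ → ℝ) (a b : Unit ⊕ Fin 3)
    (t : ℝ) : ℝ :=
  (timeDirection a * deriv φ t) * (timeDirection b * deriv φ t)
    - spacetimeMetric h t a b *
      (1 / 2 * ∑ c, ∑ d, (spacetimeMetric h t)⁻¹ c d *
          ((timeDirection c * deriv φ t) * (timeDirection d * deriv φ t))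
        + potential α (φ t))

/-- Energy-momentum tensor `(ρ + p) n_a n_b + p g_{ab}` of a perfect fluid with velocity `n`. -/
def fluidStress (h : ℝ → Matrix (Fin 3) (Fin 3) ℝ) (ρ p : ℝ → ℝ) (a b : Unit ⊕ Fin 3)
    (t : ℝ) : ℝ :=
  (ρ t + p t) * (spacetimeMetric h t a (.inl ()) * spacetimeMetric h t b (.inl ()))
    + p t * spacetimeMetric h t a b

/-- A Bianchi model in the conformal frame of `R + α R²` gravity, on an open time interval `J`:
a spatially homogeneous metric `-dt² + h_{ij}(t) ω^i ω^j`, a scalar field `φ` and a perfect fluid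
comoving with the homogeneous slices, satisfying the Einstein equations, the scalar field equation,
and the strong and dominant energy conditions. -/
structure BianchiModel (α : ℝ) {𝔤 : Type*} [LieRing 𝔤] [LieAlgebra ℝ 𝔤]
    (e : Module.Basis (Fin 3) ℝ 𝔤) where
  J : Set ℝ
  isOpen_J : IsOpen J
  ordConnected_J : J.OrdConnected
  h : ℝ → Matrix (Fin 3) (Fin 3) ℝ
  φ : ℝ → ℝ
  ρ : ℝ → ℝ
  p : ℝ → ℝ
  contDiff_h : ∀ i j, ContDiffOn ℝ 2 (fun t => h t i j) J
  posDef_h : ∀ t ∈ J, (h t).PosDef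
  contDiff_φ : ContDiffOn ℝ 2 φ J
  einstein_eq : ∀ t ∈ J, ∀ a b,
    einstein (spacetimeStructure (structureConst e)) timeDirection (spacetimeMetric h) a b t
      = scalarStress α h φ a b t + fluidStress h ρ p a b t
  scalar_eq : ∀ t ∈ J,
    waveOp (spacetimeStructure (structureConst e)) timeDirection (spacetimeMetric h) φ t
      - deriv (potential α) (φ t) = 0
  strong_energy : ∀ t ∈ J, 0 ≤ ρ t + 3 * p t
  dominant_energy : ∀ t ∈ J, |p t| ≤ ρ t

namespace BianchiModel

variable {α : ℝ} {𝔤 : Type*} [LieRing 𝔤] [LieAlgebra ℝ 𝔤] {e : Module.Basis (Fin 3) ℝ 𝔤}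

/-- Trace `K` of the extrinsic curvature. -/
def K (M : BianchiModel α e) (t : ℝ) : ℝ := expansion M.h t

/-- `σ²`. -/
def σsq (M : BianchiModel α e) (t : ℝ) : ℝ := shearSq M.h t

/-- Scalar curvature of the slice at time `t`. -/
def R3 (M : BianchiModel α e) (t : ℝ) : ℝ := spatialCurvature e (M.h t)

/-- Largest scalar curvature allowed by the determinant of the three-metric at time `t`. -/
def R3max (M : BianchiModel α e) (t : ℝ) : ℝ := spatialCurvatureMax e (M.h t)

/-- Energy density `E` of the scalar field. -/
def E (M : BianchiModel α e) (t : ℝ) : ℝ := 1 / 2 * deriv M.φ t ^ 2 + potential α (M.φ t)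

/-- `S = K² / 3 - E`. -/
def S (M : BianchiModel α e) (t : ℝ) : ℝ := 1 / 3 * M.K t ^ 2 - M.E t

/-- The potential has stayed above `η V_∞` during `[tᵢ, t]`: the time `t` lies in the effective
regime of inflation that starts at `tᵢ`. -/
def Inflating (M : BianchiModel α e) (η ti t : ℝ) : Prop :=
  ∀ s ∈ Icc ti t, η * Vinf α ≤ potential α (M.φ s)

/-- Time that the undamped equation `φ'' + V'(φ) = 0` takes for the descent from `φ(tᵢ)` to `x`
with initial speed `|φ'(tᵢ)|`. -/
def undampedTime (M : BianchiModel α e) (ti x : ℝ) : ℝ :=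
  ∫ y in x..M.φ ti, 1 / √(deriv M.φ ti ^ 2 + 2 * (potential α (M.φ ti) - potential α y))

end BianchiModel

/-- The rate `m = √(η V_∞ / 3)`. -/
def rate (α η : ℝ) : ℝ := √(η * Vinf α / 3)

end BianchiCosmology

end

/-! The Einstein equations enter only through the Hamiltonian constraint S = σ² + ρ - R/2 (`S_eq`)
and the Raychaudhuri equation. With the scalar equation they give E' = -K φ'² and S' = -(2/3) K (S +
2σ² + (ρ + 3p)/2), while R_max' = -(2/3) K R_max because R_max is a constant times det(h)^(-1/3).

While K > 0 the energy conditions give S' ≤ -(2/3) K S. Since K² = 3(S + E) and E ≥ 3m², where S is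
positive X = √(S/3 + m²) satisfies X' ≤ m² - X². Comparison with m coth(mτ) (`riccati_bound`) gives
S ≤ 3m²/sinh²(mτ) (`S_le`). The same comparison for K/3 bounds K from above.

Outside type IX, R ≤ 0 (`spatialCurvature_nonpos`): positive curvature forces a Milnor frame whose
three structure constants have one sign, hence so(3). So S ≥ 0, K cannot vanish, and S itself is σ²
+ ρ + |R|/2.

In type IX the danger is recollapse. With a = η V_∞, the quotient (E - a)/R_max³ is nondecreasing,
because E - a loses at most the rate 2K at which R_max³ decays. Together with R_max(t_i) < V_∞ ≤
(9/4) a this gives E - R_max/2 ≥ a/2 (`half_le_E_sub_R3max`), so K ≥ (3/2) λ and R_max decays like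
e^(-λτ).

The time bound holds because friction only removes energy, so φ descends no faster than without
damping (`undampedTime_le`). The last part bounds the fall of φ by that under the constant force -2
V_∞ (`φ_ge`); a high enough start then keeps φ on the plateau. -/

noncomputable section

namespace BianchiCosmology

/-! ### Behaviour of connection and curvature under a constant change of frame -/

section FrameChange

open Matrix

variable {ι : Type} [Fintype ι] [DecidableEq ι]

/-- The matrices `(Γ_a)^d_b` of the connection of a constant metric. -/
def connMatrix (C : ι → ι → ι → ℝ) (h : Matrix ι ι ℝ) (a : ι) : Matrix ι ι ℝ :=
  of fun d b => connection C 0 (fun _ => h) d a b 0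

/-- The matrices `(ad e_a)^k_b` of the adjoint representation. -/
def adMatrix (C : ι → ι → ι → ℝ) (a : ι) : Matrix ι ι ℝ := of fun k b => C k a b

/-- The curvature operators `R(e_a, e_b)` of a constant metric. -/
def curvMatrix (C : ι → ι → ι → ℝ) (h : Matrix ι ι ℝ) (a b : ι) : Matrix ι ι ℝ :=
  connMatrix C h a * connMatrix C h b - connMatrix C h b * connMatrix C h a
    - ∑ k, C k a b • connMatrix C h k

/-- The Ricci tensor of a constant metric. -/
def ricciMatrix (C : ι → ι → ι → ℝ) (h : Matrix ι ι ℝ) : Matrix ι ι ℝ :=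
  of fun c b => ∑ a, curvMatrix C h a b a c

theorem connection_const (C : ι → ι → ι → ℝ) (h : Matrix ι ι ℝ) (d a b : ι) (t : ℝ) :
    connection C 0 (fun _ => h) d a b t = connMatrix C h a d b := by
  simp [connMatrix, connection]

theorem riemann_const (C : ι → ι → ι → ℝ) (h : Matrix ι ι ℝ) (d c a b : ι) (t : ℝ) :
    riemann C 0 (fun _ => h) d c a b t = curvMatrix C h a b d c := by
  simp [riemann, curvMatrix, connection_const, Matrix.mul_apply, Matrix.sum_apply,
    Finset.sum_sub_distrib]

theorem ricci_const (C : ι → ι → ι → ℝ) (h : Matrix ι ι ℝ) (c b : ι) (t : ℝ) :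
    ricci C 0 (fun _ => h) c b t = ricciMatrix C h c b := by
  simp [ricci, ricciMatrix, riemann_const]

theorem scalarCurvature_const (C : ι → ι → ι → ℝ) (h : Matrix ι ι ℝ) (t : ℝ) :
    scalarCurvature C 0 (fun _ => h) t = (h⁻¹ * (ricciMatrix C h)ᵀ).trace := by
  simp [scalarCurvature, ricci_const, Matrix.trace, Matrix.mul_apply]

/-- The Koszul formula without derivatives splits into ad e_a, minus its metric adjoint, and a term
linear in the row of `h`. Each piece can then be transformed separately. -/
theorem connMatrix_eq {C : ι → ι → ι → ℝ} (hC : ∀ k a b, C k a b = -C k b a)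
    {h : Matrix ι ι ℝ} (hh : h.IsSymm) (hu : IsUnit h.det) (a : ι) :
    connMatrix C h a = (1 / 2 : ℝ) • (adMatrix C a - h⁻¹ * (adMatrix C a)ᵀ * h
      + h⁻¹ * ∑ k, h k a • of (C k)) := by
  have e : adMatrix C a - h⁻¹ * (adMatrix C a)ᵀ * h + h⁻¹ * ∑ k, h k a • of (C k)
      = h⁻¹ * (h * adMatrix C a - (adMatrix C a)ᵀ * h + ∑ k, h k a • of (C k)) := by
    rw [Matrix.mul_add, Matrix.mul_sub, ← Matrix.mul_assoc, Matrix.nonsing_inv_mul h hu,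
      Matrix.one_mul, Matrix.mul_assoc]
  rw [e]
  ext d b
  simp only [connMatrix, connection, of_apply, Pi.zero_apply, zero_mul, sub_zero, zero_add,
    Matrix.smul_apply, Matrix.mul_apply (M := h⁻¹), smul_eq_mul, Finset.mul_sum (a := (1 / 2 : ℝ))]
  refine Finset.sum_congr rfl fun f _ => ?_
  rw [← mul_assoc, mul_comm (h⁻¹ d f)]
  congr 1
  simp only [Matrix.add_apply, Matrix.sub_apply, Matrix.mul_apply, Matrix.sum_apply, of_apply,
    Matrix.smul_apply, smul_eq_mul, adMatrix, transpose_apply, ← Finset.sum_sub_distrib,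
    ← Finset.sum_add_distrib]
  refine Finset.sum_congr rfl fun k _ => ?_
  rw [hC k b f, hh.apply k f]
  ring

/-- The components `C'` of the tensor `C` in the frame `e'_i = A^j_i e_j`. -/
def FrameChange (A : Matrix ι ι ℝ) (C C' : ι → ι → ι → ℝ) : Prop :=
  ∀ p i j, ∑ k, A p k * C' k i j = ∑ m, ∑ n, C p m n * A m i * A n j

theorem FrameChange.ad {A : Matrix ι ι ℝ} {C C' : ι → ι → ι → ℝ} (hA : IsUnit A.det)
    (hC : FrameChange A C C') (a : ι) :
    adMatrix C' a = ∑ m, A m a • (A⁻¹ * adMatrix C m * A) := by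
  have : A * adMatrix C' a = A * ∑ m, A m a • (A⁻¹ * adMatrix C m * A) := by
    simp only [Finset.mul_sum, Matrix.mul_smul, ← Matrix.mul_assoc, Matrix.mul_nonsing_inv A hA,
      Matrix.one_mul]
    ext p j
    simp only [Matrix.mul_apply, Matrix.sum_apply, Matrix.smul_apply, smul_eq_mul,
      adMatrix, of_apply, hC p a j, Finset.mul_sum]
    refine Finset.sum_congr rfl fun m _ => Finset.sum_congr rfl fun n _ => by ring
  have h2 := congrArg (A⁻¹ * ·) this
  simpa only [← Matrix.mul_assoc, Matrix.nonsing_inv_mul A hA, Matrix.one_mul] using h2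

theorem FrameChange.form {A : Matrix ι ι ℝ} {C C' : ι → ι → ι → ℝ} (hA : IsUnit A.det)
    (hC : FrameChange A C C') (k : ι) :
    of (C' k) = ∑ p, A⁻¹ k p • (Aᵀ * of (C p) * A) := by
  ext i j
  have h1 : ∀ p, (Aᵀ * of (C p) * A) i j = ∑ k, A p k * C' k i j := by
    intro p
    simp only [hC p i j, Matrix.mul_apply, of_apply, transpose_apply, Finset.sum_mul]
    rw [Finset.sum_comm]
    refine Finset.sum_congr rfl fun m _ => Finset.sum_congr rfl fun n _ => by ring
  simp only [Matrix.sum_apply, Matrix.smul_apply, h1, smul_eq_mul, of_apply, Finset.mul_sum]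
  rw [Finset.sum_comm]
  simp only [← mul_assoc, ← Finset.sum_mul, ← Matrix.mul_apply, Matrix.nonsing_inv_mul A hA]
  simp [Matrix.one_apply]

/-- Since `A` is constant, the inhomogeneous derivative term of the usual transformation law is
absent and the connection coefficients transform as a tensor. -/
theorem FrameChange.conn {A : Matrix ι ι ℝ} {C C' : ι → ι → ι → ℝ} (hA : IsUnit A.det)
    (hC : FrameChange A C C') (hs : ∀ k a b, C k a b = -C k b a)
    (hs' : ∀ k a b, C' k a b = -C' k b a) {h : Matrix ι ι ℝ} (hh : h.IsSymm)
    (hu : IsUnit h.det) (a : ι) :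
    connMatrix C' (Aᵀ * h * A) a = ∑ m, A m a • (A⁻¹ * connMatrix C h m * A) := by
  have hAt : IsUnit Aᵀ.det := by rwa [det_transpose]
  have e1 : A * A⁻¹ = 1 := Matrix.mul_nonsing_inv A hA
  have e3 : (Aᵀ)⁻¹ * Aᵀ = 1 := Matrix.nonsing_inv_mul _ hAt
  have hform : (∑ k, (Aᵀ * h * A) k a • of (C' k))
      = ∑ m, A m a • (Aᵀ * (∑ p, h p m • of (C p)) * A) := by
    have : ∀ p, ∑ k, (Aᵀ * h * A) k a * A⁻¹ k p = ∑ m, A m a * h p m := by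
      intro p
      have : ((A⁻¹)ᵀ * (Aᵀ * h * A)) p a = (h * A) p a := by
        rw [Matrix.mul_assoc Aᵀ, ← Matrix.mul_assoc, ← Matrix.transpose_mul, e1]; simp
      simp only [Matrix.mul_apply (M := (A⁻¹)ᵀ), Matrix.mul_apply (M := h), transpose_apply] at this
      rw [Finset.sum_congr rfl fun k _ => mul_comm _ _, this]
      exact Finset.sum_congr rfl fun k _ => mul_comm _ _
    simp only [hC.form hA, Finset.smul_sum, smul_smul, Finset.mul_sum, Finset.sum_mul,
      Matrix.mul_smul, Matrix.smul_mul]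
    rw [Finset.sum_comm]
    conv_rhs => rw [Finset.sum_comm]
    refine Finset.sum_congr rfl fun p _ => ?_
    rw [← Finset.sum_smul, ← Finset.sum_smul, this]
  have hinv : (Aᵀ * h * A)⁻¹ = A⁻¹ * h⁻¹ * (Aᵀ)⁻¹ := by
    rw [Matrix.mul_inv_rev, Matrix.mul_inv_rev, Matrix.mul_assoc]
  have hh' : (Aᵀ * h * A).IsSymm := by
    simp [Matrix.IsSymm, Matrix.transpose_mul, hh.eq, Matrix.mul_assoc]
  have hu' : IsUnit (Aᵀ * h * A).det := by
    rw [det_mul, det_mul]; exact (hAt.mul hu).mul hA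
  rw [connMatrix_eq hs' hh' hu', hform, hinv, hC.ad hA]
  simp only [connMatrix_eq hs hh hu, Matrix.transpose_sum, Matrix.transpose_smul]
  rw [Matrix.mul_sum, Matrix.mul_sum, Matrix.sum_mul, ← Finset.sum_sub_distrib,
    ← Finset.sum_add_distrib, Finset.smul_sum]
  refine Finset.sum_congr rfl fun m _ => ?_
  simp only [Matrix.mul_smul, Matrix.smul_mul, ← smul_sub, ← smul_add]
  rw [smul_comm]
  congr 2
  rw [Matrix.mul_add, Matrix.mul_sub, Matrix.add_mul, Matrix.sub_mul]
  simp only [Matrix.transpose_mul, Matrix.transpose_nonsing_inv, Matrix.mul_assoc]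
  rw [← Matrix.mul_assoc (Aᵀ)⁻¹ Aᵀ, e3, Matrix.one_mul, ← Matrix.mul_assoc (Aᵀ)⁻¹ Aᵀ, e3,
    Matrix.one_mul, ← Matrix.mul_assoc (Aᵀ)⁻¹ Aᵀ, e3, Matrix.one_mul]

theorem FrameChange.curv {A : Matrix ι ι ℝ} {C C' : ι → ι → ι → ℝ} (hA : IsUnit A.det)
    (hC : FrameChange A C C') (hs : ∀ k a b, C k a b = -C k b a)
    (hs' : ∀ k a b, C' k a b = -C' k b a) {h : Matrix ι ι ℝ} (hh : h.IsSymm)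
    (hu : IsUnit h.det) (a b : ι) :
    curvMatrix C' (Aᵀ * h * A) a b
      = ∑ m, ∑ n, (A m a * A n b) • (A⁻¹ * curvMatrix C h m n * A) := by
  have e1 : A * A⁻¹ = 1 := Matrix.mul_nonsing_inv A hA
  have hprod : ∀ X Y : Matrix ι ι ℝ, (A⁻¹ * X * A) * (A⁻¹ * Y * A) = A⁻¹ * (X * Y) * A := by
    intro X Y
    simp only [Matrix.mul_assoc]
    rw [← Matrix.mul_assoc A A⁻¹, e1, Matrix.one_mul]
  have hmul : ∀ a b, connMatrix C' (Aᵀ * h * A) a * connMatrix C' (Aᵀ * h * A) b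
      = ∑ m, ∑ n, (A m a * A n b) •
        (A⁻¹ * (connMatrix C h m * connMatrix C h n) * A) := by
    intro a b
    rw [hC.conn hA hs hs' hh hu, hC.conn hA hs hs' hh hu]
    simp only [Matrix.sum_mul, Matrix.mul_sum, Matrix.smul_mul, Matrix.mul_smul, hprod,
      Finset.smul_sum, smul_smul]
    rw [Finset.sum_comm]
    refine Finset.sum_congr rfl fun m _ => Finset.sum_congr rfl fun n _ => by rw [mul_comm]
  have hlin : ∑ k, C' k a b • connMatrix C' (Aᵀ * h * A) k
      = ∑ m, ∑ n, (A m a * A n b) • (A⁻¹ * (∑ k, C k m n • connMatrix C h k) * A) := by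
    simp only [hC.conn hA hs hs' hh hu, Finset.smul_sum, smul_smul, Matrix.mul_sum,
      Matrix.sum_mul, Matrix.mul_smul, Matrix.smul_mul]
    rw [Finset.sum_comm]
    conv_rhs =>
      enter [2, m]
      rw [Finset.sum_comm]
    conv_rhs => rw [Finset.sum_comm]
    refine Finset.sum_congr rfl fun p _ => ?_
    simp only [← Finset.sum_smul]
    congr 1
    rw [Finset.sum_congr rfl fun k _ => mul_comm _ _, hC p a b]
    refine Finset.sum_congr rfl fun m _ => Finset.sum_congr rfl fun n _ => by ring
  rw [curvMatrix, hmul a b, hmul b a, hlin,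
    Finset.sum_comm (γ := ι) (f := fun m n => (A m b * A n a) • _),
    ← Finset.sum_sub_distrib, ← Finset.sum_sub_distrib]
  refine Finset.sum_congr rfl fun m _ => ?_
  rw [← Finset.sum_sub_distrib, ← Finset.sum_sub_distrib]
  refine Finset.sum_congr rfl fun n _ => ?_
  rw [mul_comm (A n b), ← smul_sub, ← smul_sub, curvMatrix, Matrix.mul_sub,
    Matrix.mul_sub, Matrix.sub_mul, Matrix.sub_mul]

/-- In the contraction of the first and third indices, `A` cancels against `A⁻¹`; only the two free
indices keep their factors. -/
theorem FrameChange.ricciTensor {A : Matrix ι ι ℝ} {C C' : ι → ι → ι → ℝ} (hA : IsUnit A.det)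
    (hC : FrameChange A C C') (hs : ∀ k a b, C k a b = -C k b a)
    (hs' : ∀ k a b, C' k a b = -C' k b a) {h : Matrix ι ι ℝ} (hh : h.IsSymm) (hu : IsUnit h.det) :
    ricciMatrix C' (Aᵀ * h * A) = Aᵀ * ricciMatrix C h * A := by
  have e1 : A * A⁻¹ = 1 := Matrix.mul_nonsing_inv A hA
  have key : ∀ (m : ι) (X : Matrix ι ι ℝ) (c : ι),
      ∑ a, A m a * (A⁻¹ * X * A) a c = (X * A) m c := by
    intro m X c
    rw [← Matrix.mul_apply, ← Matrix.mul_assoc, ← Matrix.mul_assoc, e1, Matrix.one_mul]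
  ext c b
  simp only [ricciMatrix, of_apply, hC.curv hA hs hs' hh hu,
    Matrix.sum_apply, Matrix.smul_apply, smul_eq_mul]
  rw [Finset.sum_comm]
  conv_lhs =>
    enter [2, m]
    rw [Finset.sum_comm]
    enter [2, n]
    rw [Finset.sum_congr rfl fun a _ => mul_right_comm _ _ _, ← Finset.sum_mul, key]
  simp only [Matrix.mul_apply, transpose_apply, of_apply, Finset.sum_mul, Finset.mul_sum]
  rw [Finset.sum_comm]
  refine Finset.sum_congr rfl fun n _ => ?_
  rw [Finset.sum_comm]
  refine Finset.sum_congr rfl fun m _ => Finset.sum_congr rfl fun k _ => by ring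

/-- The scalar curvature does not depend on the frame. -/
theorem FrameChange.scalar {A : Matrix ι ι ℝ} {C C' : ι → ι → ι → ℝ}
    (hA : IsUnit A.det) (hC : FrameChange A C C') (hs : ∀ k a b, C k a b = -C k b a)
    (hs' : ∀ k a b, C' k a b = -C' k b a) {h : Matrix ι ι ℝ} (hh : h.IsSymm) (hu : IsUnit h.det)
    (t s : ℝ) :
    scalarCurvature C' 0 (fun _ => Aᵀ * h * A) t = scalarCurvature C 0 (fun _ => h) s := by
  have hAt : IsUnit Aᵀ.det := by rwa [det_transpose]
  have e1 : A * A⁻¹ = 1 := Matrix.mul_nonsing_inv A hA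
  have e3 : (Aᵀ)⁻¹ * Aᵀ = 1 := Matrix.nonsing_inv_mul _ hAt
  rw [scalarCurvature_const, scalarCurvature_const, hC.ricciTensor hA hs hs' hh hu,
    Matrix.mul_inv_rev, Matrix.mul_inv_rev]
  simp only [Matrix.transpose_mul, Matrix.transpose_transpose]
  rw [Matrix.trace_mul_comm]
  simp only [Matrix.mul_assoc]
  rw [Matrix.trace_mul_comm]
  simp only [Matrix.mul_assoc]
  rw [← Matrix.mul_assoc A, e1, Matrix.one_mul, e3, Matrix.mul_one, Matrix.trace_mul_comm]

end FrameChange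

/-! ### Three-dimensional Lie algebras through the dual structure tensor -/

section ThreeDim

open Matrix

/-- The dual structure tensor `N^{kl}`, with `C^k_{ij} = N^{kl} ε_{lij}`. -/
def dualStructure (C : Fin 3 → Fin 3 → Fin 3 → ℝ) : Matrix (Fin 3) (Fin 3) ℝ :=
  of fun k l => C k (l + 1) (l + 2)

/-- Contracting an antisymmetric pair of lower indices with two copies of `A` produces the cofactors
of `A`. Hence N transforms as a tensor density, with a factor `A.det`. -/
theorem dualStructure_frameChange {A : Matrix (Fin 3) (Fin 3) ℝ}
    {C C' : Fin 3 → Fin 3 → Fin 3 → ℝ} (hC : FrameChange A C C')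
    (hs : ∀ k a b, C k a b = -C k b a) :
    A * dualStructure C' * Aᵀ = A.det • dualStructure C := by
  have h1 : A * dualStructure C' = dualStructure C * (adjugate A)ᵀ := by
    have hd : ∀ k a, C k a a = 0 := fun k a => by linarith [hs k a a]
    ext p l
    have := hC p (l + 1) (l + 2)
    simp only [Matrix.mul_apply, dualStructure, of_apply, this]
    rw [adjugate_fin_three]
    fin_cases l <;>
    · simp [Fin.sum_univ_three, hd]
      rw [hs p 0 2, hs p 2 1, hs p 1 0]
      ring
  rw [h1, Matrix.mul_assoc, ← Matrix.transpose_mul, Matrix.mul_adjugate]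
  simp

/-- In an orthonormal frame the symmetric part n and the antisymmetric part a of N decouple: the
value is (tr n)²/2 - tr n² - 6|a|², where |a|² sums the squares of the three independent entries. -/
theorem scalarCurvature_one (C : Fin 3 → Fin 3 → Fin 3 → ℝ) (hs : ∀ k a b, C k a b = -C k b a)
    (t : ℝ) :
    scalarCurvature C 0 (fun _ => 1) t =
      1 / 2 * (dualStructure C).trace ^ 2
      - (dualStructure C 0 0 ^ 2 + dualStructure C 1 1 ^ 2 + dualStructure C 2 2 ^ 2
        + (dualStructure C 0 1 + dualStructure C 1 0) ^ 2 / 2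
        + (dualStructure C 0 2 + dualStructure C 2 0) ^ 2 / 2
        + (dualStructure C 1 2 + dualStructure C 2 1) ^ 2 / 2)
      - 3 / 2 * ((dualStructure C 0 1 - dualStructure C 1 0) ^ 2
        + (dualStructure C 0 2 - dualStructure C 2 0) ^ 2
        + (dualStructure C 1 2 - dualStructure C 2 1) ^ 2) := by
  have hd : ∀ k a, C k a a = 0 := fun k a => by linarith [hs k a a]
  have hconn : ∀ a d b, connMatrix C 1 a d b = (C d a b - C b a d - C a b d) / 2 := by
    intro a d b
    simp [connMatrix, connection, Matrix.one_apply, Finset.sum_sub_distrib]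
    ring
  simp only [scalarCurvature_const, inv_one, Matrix.one_mul, Matrix.trace, diag_apply,
    transpose_apply, ricciMatrix, of_apply, curvMatrix, Matrix.sub_apply, Matrix.mul_apply,
    dualStructure, Fin.sum_univ_three, Matrix.add_apply, Matrix.smul_apply, smul_eq_mul, hconn]
  simp [hd, hs _ 1 0, hs _ 2 0, hs _ 2 1]
  ring

/-- In dimension three the Jacobi identity says that N annihilates the axial vector of its own
antisymmetric part. -/
theorem jacobi_dualStructure {C : Fin 3 → Fin 3 → Fin 3 → ℝ} (hs : ∀ k a b, C k a b = -C k b a)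
    (hJ : ∀ p, ∑ m, (C m 0 1 * C p m 2 + C m 1 2 * C p m 0 + C m 2 0 * C p m 1) = 0) (p : Fin 3) :
    dualStructure C p 0 * (dualStructure C 1 2 - dualStructure C 2 1)
      + dualStructure C p 1 * (dualStructure C 2 0 - dualStructure C 0 2)
      + dualStructure C p 2 * (dualStructure C 0 1 - dualStructure C 1 0) = 0 := by
  have hd : ∀ k a, C k a a = 0 := fun k a => by linarith [hs k a a]
  have := hJ p
  simp [Fin.sum_univ_three, hd, dualStructure] at this ⊢
  rw [hs p 1 0, hs p 2 1, hs p 0 2] at this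
  linarith

variable {𝔤 : Type*} [LieRing 𝔤] [LieAlgebra ℝ 𝔤]

theorem structureConst_antisymm (e : Module.Basis (Fin 3) ℝ 𝔤) (k a b : Fin 3) :
    structureConst e k a b = -structureConst e k b a := by
  rw [structureConst, structureConst, ← lie_skew, map_neg, Finsupp.neg_apply]

theorem structureConst_jacobi (e : Module.Basis (Fin 3) ℝ 𝔤) (p : Fin 3) :
    ∑ m, (structureConst e m 0 1 * structureConst e p m 2
      + structureConst e m 1 2 * structureConst e p m 0
      + structureConst e m 2 0 * structureConst e p m 1) = 0 := by
  have key : ∀ i j k, ∑ m, structureConst e m i j * structureConst e p m k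
      = e.repr ⁅⁅e i, e j⁆, e k⁆ p := by
    intro i j k
    conv_rhs => rw [← e.sum_repr ⁅e i, e j⁆]
    simp only [sum_lie, smul_lie, map_sum, map_smul, Finsupp.coe_finsetSum,
      Finset.sum_apply, Finsupp.smul_apply, smul_eq_mul, structureConst]
  simp only [Finset.sum_add_distrib, key]
  rw [← Finsupp.add_apply, ← Finsupp.add_apply, ← map_add, ← map_add]
  have : ⁅⁅e 0, e 1⁆, e 2⁆ + ⁅⁅e 1, e 2⁆, e 0⁆ + ⁅⁅e 2, e 0⁆, e 1⁆ = 0 := by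
    rw [← lie_skew ⁅e 0, e 1⁆, ← lie_skew ⁅e 1, e 2⁆, ← lie_skew ⁅e 2, e 0⁆, ← neg_add, ← neg_add,
      neg_eq_zero, add_comm, ← add_assoc]
    exact lie_jacobi (e 1) (e 2) (e 0)
  rw [this]; simp

theorem frameChange_structureConst (e e' : Module.Basis (Fin 3) ℝ 𝔤) :
    FrameChange (e.toMatrix e') (structureConst e) (structureConst e') := by
  intro p i j
  have h1 : ∀ x : 𝔤, ∑ k, e.toMatrix e' p k * e'.repr x k = e.repr x p := by
    intro x
    exact congrFun (e'.toMatrix_mulVec_repr e x) p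
  have h2 : ∀ j, e' j = ∑ n, e.toMatrix e' n j • e n := fun j =>
    (e.sum_toMatrix_smul_self e' j).symm
  simp only [structureConst]
  rw [h1, h2 i, h2 j]
  simp only [sum_lie, lie_sum, lie_smul, smul_lie, map_sum,
    map_smul, Finsupp.coe_finsetSum, Finset.sum_apply, Finsupp.smul_apply, smul_eq_mul]
  simp only [Finset.mul_sum]
  rw [Finset.sum_comm]
  refine Finset.sum_congr rfl fun m _ => Finset.sum_congr rfl fun n _ => by ring

theorem spatialCurvature_basis (e e' : Module.Basis (Fin 3) ℝ 𝔤) {h : Matrix (Fin 3) (Fin 3) ℝ}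
    (hh : h.PosDef) :
    spatialCurvature e' ((e.toMatrix e')ᵀ * h * e.toMatrix e') = spatialCurvature e h := by
  refine (frameChange_structureConst e e').scalar ?_ (structureConst_antisymm e)
    (structureConst_antisymm e') ?_ ?_ _ _
  · have := e.toMatrix_mul_toMatrix_flip e'
    exact (Matrix.isUnit_iff_isUnit_det _).1 (IsUnit.of_mul_eq_one _ this)
  · exact hh.isHermitian
  · exact hh.det_pos.ne'.isUnit

theorem exists_basis_toMatrix (e : Module.Basis (Fin 3) ℝ 𝔤) {A : Matrix (Fin 3) (Fin 3) ℝ}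
    (hA : IsUnit A.det) : ∃ e' : Module.Basis (Fin 3) ℝ 𝔤, e.toMatrix e' = A := by
  refine ⟨e.map (Matrix.toLinearEquiv e A hA), ?_⟩
  ext i j
  simp [Module.Basis.toMatrix_apply, Matrix.toLinearEquiv, Matrix.toLin_self,
    Finsupp.single_apply]

theorem exists_orthogonal_diagonal {n : Type*} [Fintype n] [DecidableEq n] {S : Matrix n n ℝ}
    (hS : S.IsSymm) : ∃ (U : Matrix n n ℝ) (d : n → ℝ), Uᵀ * U = 1 ∧ Uᵀ * S * U = diagonal d := by
  have hS' : S.IsHermitian := by simpa [Matrix.IsHermitian, Matrix.IsSymm] using hS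
  refine ⟨hS'.eigenvectorUnitary, hS'.eigenvalues, ?_, ?_⟩
  · simpa [Matrix.star_eq_conjTranspose] using Unitary.coe_star_mul_self hS'.eigenvectorUnitary
  · have := hS'.conjStarAlgAut_star_eigenvectorUnitary
    simpa [Unitary.conjStarAlgAut_star_apply, Matrix.star_eq_conjTranspose, Function.comp_def]
      using this

theorem exists_transpose_mul_mul_eq_one {n : Type*} [Fintype n] [DecidableEq n]
    {h : Matrix n n ℝ} (hh : h.PosDef) : ∃ A : Matrix n n ℝ, Aᵀ * h * A = 1 := by
  obtain ⟨U, d, hU, hd⟩ := exists_orthogonal_diagonal (S := h) hh.isHermitian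
  have hpos : ∀ i, 0 < d i := by
    intro i
    have hinj : Function.Injective U.mulVec := by
      intro x y hxy
      have := congrArg (Uᵀ.mulVec) hxy
      simpa [hU] using this
    have := (hh.conjTranspose_mul_mul_same hinj).diag_pos (i := i)
    simpa [hd] using this
  refine ⟨U * diagonal fun i => (√(d i))⁻¹, ?_⟩
  rw [Matrix.transpose_mul, diagonal_transpose]
  have : diagonal (fun i => (√(d i))⁻¹) * Uᵀ * h * (U * diagonal fun i => (√(d i))⁻¹)
      = diagonal (fun i => (√(d i))⁻¹) * (Uᵀ * h * U) * diagonal fun i => (√(d i))⁻¹ := by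
    simp only [Matrix.mul_assoc]
  rw [this, hd, diagonal_mul_diagonal, diagonal_mul_diagonal, ← diagonal_one]
  congr 1
  ext i
  have h1 := Real.mul_self_sqrt (hpos i).le
  have h2 := Real.sqrt_pos.2 (hpos i)
  field_simp
  linarith

/-- A metric has an orthonormal frame which diagonalizes the symmetric part of the dual structure
tensor. -/
theorem exists_orthonormal_diagonal (e : Module.Basis (Fin 3) ℝ 𝔤)
    {h : Matrix (Fin 3) (Fin 3) ℝ} (hh : h.PosDef) :
    ∃ e' : Module.Basis (Fin 3) ℝ 𝔤, (e.toMatrix e')ᵀ * h * e.toMatrix e' = 1 ∧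
      ∀ i j, i ≠ j → dualStructure (structureConst e') i j
        = -dualStructure (structureConst e') j i := by
  have unit_of : ∀ {B A : Matrix (Fin 3) (Fin 3) ℝ}, B * A = 1 → IsUnit A.det := by
    intro B A hBA
    exact (Matrix.isUnit_iff_isUnit_det _).1 (IsUnit.of_mul_eq_one_right _ hBA)
  obtain ⟨A, hA⟩ := exists_transpose_mul_mul_eq_one hh
  obtain ⟨e₁, he₁⟩ := exists_basis_toMatrix e (unit_of hA)
  set N := dualStructure (structureConst e₁) with hN
  -- A rotation keeps the frame orthonormal and conjugates N up to the factor `U.det`, so this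
  -- remaining freedom diagonalizes the symmetric part.
  obtain ⟨U, d, hU, hd⟩ := exists_orthogonal_diagonal (S := N + Nᵀ)
    (by simp [Matrix.IsSymm, add_comm])
  obtain ⟨e₂, he₂⟩ := exists_basis_toMatrix e₁ (unit_of hU)
  have hmat : e.toMatrix e₂ = A * U := by
    rw [← he₁, ← he₂, Module.Basis.toMatrix_mul_toMatrix]
  have hN₂ : dualStructure (structureConst e₂) = U.det • (Uᵀ * N * U) := by
    have := dualStructure_frameChange (frameChange_structureConst e₁ e₂)
      (structureConst_antisymm e₁)
    rw [he₂, ← hN] at this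
    have h3 := congrArg (fun X => Uᵀ * X * U) this
    simp only [Matrix.mul_smul, Matrix.smul_mul] at h3
    rw [← h3]
    simp only [Matrix.mul_assoc, hU, Matrix.mul_one]
    rw [← Matrix.mul_assoc, hU, Matrix.one_mul]
  refine ⟨e₂, ?_, ?_⟩
  · rw [hmat, Matrix.transpose_mul]
    have : Uᵀ * Aᵀ * h * (A * U) = Uᵀ * (Aᵀ * h * A) * U := by simp only [Matrix.mul_assoc]
    rw [this, hA, Matrix.mul_one, hU]
  · intro i j hij
    have h4 : dualStructure (structureConst e₂) + (dualStructure (structureConst e₂))ᵀ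
        = U.det • diagonal d := by
      rw [hN₂, ← hd, Matrix.transpose_smul, ← smul_add]
      congr 1
      simp only [Matrix.transpose_mul, Matrix.transpose_transpose, Matrix.mul_add, Matrix.add_mul,
        Matrix.mul_assoc]
    have h5 := congrFun (congrFun h4 i) j
    simp [hij] at h5
    linarith

end ThreeDim

/-! ### Positive curvature characterizes type IX; the maximal curvature -/

section Curvature

open Matrix Pointwise

variable {𝔤 : Type*} [LieRing 𝔤] [LieAlgebra ℝ 𝔤]

theorem spatialCurvature_one (e : Module.Basis (Fin 3) ℝ 𝔤) :
    spatialCurvature e 1 =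
      1 / 2 * (dualStructure (structureConst e)).trace ^ 2
      - (dualStructure (structureConst e) 0 0 ^ 2 + dualStructure (structureConst e) 1 1 ^ 2
        + dualStructure (structureConst e) 2 2 ^ 2
        + (dualStructure (structureConst e) 0 1 + dualStructure (structureConst e) 1 0) ^ 2 / 2
        + (dualStructure (structureConst e) 0 2 + dualStructure (structureConst e) 2 0) ^ 2 / 2
        + (dualStructure (structureConst e) 1 2 + dualStructure (structureConst e) 2 1) ^ 2 / 2)
      - 3 / 2 * ((dualStructure (structureConst e) 0 1 - dualStructure (structureConst e) 1 0) ^ 2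
        + (dualStructure (structureConst e) 0 2 - dualStructure (structureConst e) 2 0) ^ 2
        + (dualStructure (structureConst e) 1 2 - dualStructure (structureConst e) 2 1) ^ 2) :=
  scalarCurvature_one _ (structureConst_antisymm e) 0

/-- The Jacobi identity makes each antisymmetric entry times the complementary diagonal entry
vanish. If a diagonal entry is 0, then R is minus half the squared difference of the other two,
minus squares, so R ≤ 0; hence the antisymmetric part is zero. The signs follow from R = 2xy - (x +
y - z)²/2 and its permutations. -/
theorem eq_diagonal_of_curvature_pos {N : Matrix (Fin 3) (Fin 3) ℝ} {R : ℝ}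
    (hd : ∀ i j, i ≠ j → N i j = -N j i)
    (hJ : ∀ p, N p 0 * (N 1 2 - N 2 1) + N p 1 * (N 2 0 - N 0 2) + N p 2 * (N 0 1 - N 1 0) = 0)
    (hR : R = 1 / 2 * N.trace ^ 2 - (N 0 0 ^ 2 + N 1 1 ^ 2 + N 2 2 ^ 2
        + (N 0 1 + N 1 0) ^ 2 / 2 + (N 0 2 + N 2 0) ^ 2 / 2 + (N 1 2 + N 2 1) ^ 2 / 2)
      - 3 / 2 * ((N 0 1 - N 1 0) ^ 2 + (N 0 2 - N 2 0) ^ 2 + (N 1 2 - N 2 1) ^ 2))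
    (hpos : 0 < R) : ∃ x y z : ℝ, N = diagonal ![x, y, z] ∧ 0 < x * y ∧ 0 < y * z ∧ 0 < x * z ∧
      R = 1 / 2 * (x + y + z) ^ 2 - (x ^ 2 + y ^ 2 + z ^ 2) := by
  have h0 := hJ 0
  have h1 := hJ 1
  have h2 := hJ 2
  have h10 := hd 1 0 (by decide)
  have h20 := hd 2 0 (by decide)
  have h21 := hd 2 1 (by decide)
  rw [trace_fin_three, h10, h20, h21] at hR
  rw [h10, h20, h21] at h0 h1 h2
  have hR' : R = 1 / 2 * (N 0 0 + N 1 1 + N 2 2) ^ 2 - (N 0 0 ^ 2 + N 1 1 ^ 2 + N 2 2 ^ 2)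
      - 6 * (N 0 1 ^ 2 + N 0 2 ^ 2 + N 1 2 ^ 2) := by rw [hR]; ring
  have hxw : N 0 0 * N 1 2 = 0 := by linarith
  have hyv : N 1 1 * N 0 2 = 0 := by linarith
  have hzu : N 2 2 * N 0 1 = 0 := by linarith
  clear h0 h1 h2 hR
  have hw : N 1 2 = 0 := by
    rcases mul_eq_zero.1 hxw with h | h
    · rw [hR', h] at hpos
      nlinarith [sq_nonneg (N 1 1 - N 2 2), sq_nonneg (N 0 1), sq_nonneg (N 0 2),
        sq_nonneg (N 1 2)]
    · exact h
  have hv : N 0 2 = 0 := by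
    rcases mul_eq_zero.1 hyv with h | h
    · rw [hR', h] at hpos
      nlinarith [sq_nonneg (N 0 0 - N 2 2), sq_nonneg (N 0 1), sq_nonneg (N 0 2),
        sq_nonneg (N 1 2)]
    · exact h
  have hu : N 0 1 = 0 := by
    rcases mul_eq_zero.1 hzu with h | h
    · rw [hR', h] at hpos
      nlinarith [sq_nonneg (N 1 1 - N 0 0), sq_nonneg (N 0 1), sq_nonneg (N 0 2),
        sq_nonneg (N 1 2)]
    · exact h
  rw [hu, hv, hw] at hR'
  rw [hu] at h10
  rw [hv] at h20
  rw [hw] at h21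
  refine ⟨N 0 0, N 1 1, N 2 2, ?_, ?_, ?_, ?_, ?_⟩
  · ext i j
    fin_cases i <;> fin_cases j <;> simp [hu, hv, hw, h10, h20, h21]
  · nlinarith [sq_nonneg (N 0 0 + N 1 1 - N 2 2)]
  · nlinarith [sq_nonneg (N 1 1 + N 2 2 - N 0 0)]
  · nlinarith [sq_nonneg (N 0 0 + N 2 2 - N 1 1)]
  · rw [hR']; ring

/-- A left-invariant metric of positive scalar curvature has an orthonormal frame with
`[e₂, e₃] = x e₁`, `[e₃, e₁] = y e₂`, `[e₁, e₂] = z e₃` where `x`, `y`, `z` have the same sign. -/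
theorem exists_milnor_frame (e : Module.Basis (Fin 3) ℝ 𝔤) {h : Matrix (Fin 3) (Fin 3) ℝ}
    (hh : h.PosDef) (hR : 0 < spatialCurvature e h) :
    ∃ (e' : Module.Basis (Fin 3) ℝ 𝔤) (x y z : ℝ), (e.toMatrix e')ᵀ * h * e.toMatrix e' = 1 ∧
      dualStructure (structureConst e') = diagonal ![x, y, z] ∧ 0 < x * y ∧ 0 < y * z ∧ 0 < x * z ∧
      spatialCurvature e h = 1 / 2 * (x + y + z) ^ 2 - (x ^ 2 + y ^ 2 + z ^ 2) := by
  obtain ⟨e', he', hd⟩ := exists_orthonormal_diagonal e hh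
  rw [← spatialCurvature_basis e e' hh, he'] at hR ⊢
  obtain ⟨x, y, z, h⟩ := eq_diagonal_of_curvature_pos hd
    (jacobi_dualStructure (structureConst_antisymm e') (structureConst_jacobi e'))
    (spatialCurvature_one e') hR
  exact ⟨e', x, y, z, he', h⟩

theorem structureConst_eq_of_lie {e : Module.Basis (Fin 3) ℝ 𝔤}
    (h : ∀ i, ⁅e (i + 1), e (i + 2)⁆ = e i) : dualStructure (structureConst e) = 1 := by
  ext i j
  simp [dualStructure, structureConst, h, Finsupp.single_apply, Matrix.one_apply, eq_comm]

/-- The cross product matrices. -/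
def crossMatrix (v : Fin 3 → ℝ) : Matrix (Fin 3) (Fin 3) ℝ :=
  !![0, -v 2, v 1; v 2, 0, -v 0; -v 1, v 0, 0]

/-- Coordinates on `so(3)`. -/
def soEquiv : LieAlgebra.Orthogonal.so (Fin 3) ℝ ≃ₗ[ℝ] (Fin 3 → ℝ) where
  toFun M := ![M.1 2 1, M.1 0 2, M.1 1 0]
  map_add' M M' := by ext i; fin_cases i <;> simp
  map_smul' r M := by ext i; fin_cases i <;> simp
  invFun v := ⟨crossMatrix v, by
    rw [LieAlgebra.Orthogonal.mem_so]
    ext i j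
    fin_cases i <;> fin_cases j <;> simp [crossMatrix]⟩
  left_inv M := by
    have h := (LieAlgebra.Orthogonal.mem_so (Fin 3) ℝ M.1).1 M.2
    have h' : ∀ i j, M.1 j i = -M.1 i j := fun i j => congrFun (congrFun h i) j
    have h0 : ∀ i, M.1 i i = 0 := fun i => by linarith [h' i i]
    ext i j
    fin_cases i <;> fin_cases j <;> simp [crossMatrix, h0, h' 1 0, h' 0 2, h' 2 1]
  right_inv v := by
    ext i
    fin_cases i <;> simp [crossMatrix]

/-- The standard basis of `so(3)`. -/
def soBasis : Module.Basis (Fin 3) ℝ (LieAlgebra.Orthogonal.so (Fin 3) ℝ) :=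
  Module.Basis.ofEquivFun soEquiv

theorem soBasis_lie (i : Fin 3) : ⁅soBasis (i + 1), soBasis (i + 2)⁆ = soBasis i := by
  have hb : ∀ i, (soBasis i : Matrix (Fin 3) (Fin 3) ℝ) = crossMatrix (Pi.single i 1) := by
    intro i
    simp [soBasis, soEquiv]
  apply Subtype.ext
  change (soBasis (i + 1) : Matrix (Fin 3) (Fin 3) ℝ) * soBasis (i + 2)
    - (soBasis (i + 2) : Matrix (Fin 3) (Fin 3) ℝ) * soBasis (i + 1) = soBasis i
  rw [hb, hb, hb]
  ext a b
  fin_cases i <;> fin_cases a <;> fin_cases b <;>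
    simp [crossMatrix]

/-- Type IX is handled throughout by a basis with cyclic brackets, the cross product on ℝ³. -/
theorem isTypeIX_iff :
    IsTypeIX 𝔤 ↔ ∃ e : Module.Basis (Fin 3) ℝ 𝔤, ∀ i, ⁅e (i + 1), e (i + 2)⁆ = e i := by
  constructor
  · rintro ⟨φ⟩
    refine ⟨soBasis.map φ.symm.toLinearEquiv, fun i => ?_⟩
    have := congrArg φ.symm (soBasis_lie i)
    rwa [LieEquiv.map_lie] at this
  · rintro ⟨e, he⟩
    have hlie : ∀ i j, e.equiv soBasis (Equiv.refl _) ⁅e i, e j⁆ = ⁅soBasis i, soBasis j⁆ := by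
      have key : ∀ i, e.equiv soBasis (Equiv.refl _) ⁅e (i + 1), e (i + 2)⁆
          = ⁅soBasis (i + 1), soBasis (i + 2)⁆ := fun i => by
        rw [he, soBasis_lie]; simp
      have key' : ∀ i, e.equiv soBasis (Equiv.refl _) ⁅e (i + 2), e (i + 1)⁆
          = ⁅soBasis (i + 2), soBasis (i + 1)⁆ := fun i => by
        rw [← lie_skew, map_neg, key, lie_skew]
      intro i j
      have h0 := key 0
      have h1 := key 1
      have h2 := key 2
      have h0' := key' 0
      have h1' := key' 1
      have h2' := key' 2
      fin_cases i <;> fin_cases j <;> first | assumption | simp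
    refine ⟨{ e.equiv soBasis (Equiv.refl _) with map_lie' := ?_ }⟩
    intro x y
    change e.equiv soBasis (Equiv.refl _) ⁅x, y⁆
      = ⁅e.equiv soBasis (Equiv.refl _) x, e.equiv soBasis (Equiv.refl _) y⁆
    rw [← e.sum_repr x, ← e.sum_repr y]
    simp only [sum_lie, lie_sum, smul_lie, lie_smul, map_sum, map_smul, hlie,
      Module.Basis.equiv_apply, Equiv.refl_apply]

/-- Multiplying the vectors of a Milnor frame by `c₀`, `c₁`, `c₂` then turns all three structure
constants into 1. -/
theorem exists_rescaling {x y z : ℝ} (hxy : 0 < x * y) (hyz : 0 < y * z) :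
    ∃ c₀ c₁ c₂ : ℝ, c₀ ≠ 0 ∧ c₁ ≠ 0 ∧ c₂ ≠ 0 ∧
      c₁ * c₂ * x = c₀ ∧ c₂ * c₀ * y = c₁ ∧ c₀ * c₁ * z = c₂ := by
  have pos : ∀ {x y z : ℝ}, 0 < x → 0 < y → 0 < z → ∃ c₀ c₁ c₂ : ℝ, c₀ ≠ 0 ∧ c₁ ≠ 0 ∧ c₂ ≠ 0 ∧
      c₁ * c₂ * x = c₀ ∧ c₂ * c₀ * y = c₁ ∧ c₀ * c₁ * z = c₂ := by
    intro x y z hx hy hz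
    -- Square roots make the solution rational: for x = a², y = b², z = c² it is 1/(bc), 1/(ca),
    -- 1/(ab). Three negative constants reduce to this case by reversing every vector.
    obtain ⟨a, ha, rfl⟩ : ∃ a : ℝ, 0 < a ∧ a ^ 2 = x := ⟨√x, Real.sqrt_pos.2 hx, Real.sq_sqrt hx.le⟩
    obtain ⟨b, hb, rfl⟩ : ∃ a : ℝ, 0 < a ∧ a ^ 2 = y := ⟨√y, Real.sqrt_pos.2 hy, Real.sq_sqrt hy.le⟩
    obtain ⟨c, hc, rfl⟩ : ∃ a : ℝ, 0 < a ∧ a ^ 2 = z := ⟨√z, Real.sqrt_pos.2 hz, Real.sq_sqrt hz.le⟩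
    refine ⟨1 / (b * c), 1 / (c * a), 1 / (a * b), by positivity, by positivity, by positivity,
      ?_, ?_, ?_⟩ <;> field_simp
  rcases pos_and_pos_or_neg_and_neg_of_mul_pos hxy with ⟨hx, hy⟩ | ⟨hx, hy⟩
  · exact pos hx hy ((mul_pos_iff_of_pos_left hy).1 hyz)
  · have hz : z < 0 := by
      by_contra hz
      nlinarith [not_lt.1 hz]
    obtain ⟨c₀, c₁, c₂, h₀, h₁, h₂, e₀, e₁, e₂⟩ := pos (neg_pos.2 hx) (neg_pos.2 hy) (neg_pos.2 hz)
    exact ⟨-c₀, -c₁, -c₂, neg_ne_zero.2 h₀, neg_ne_zero.2 h₁, neg_ne_zero.2 h₂,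
      by linear_combination -e₀, by linear_combination -e₁, by linear_combination -e₂⟩

theorem isTypeIX_of_spatialCurvature_pos (e : Module.Basis (Fin 3) ℝ 𝔤)
    {h : Matrix (Fin 3) (Fin 3) ℝ} (hh : h.PosDef) (hR : 0 < spatialCurvature e h) :
    IsTypeIX 𝔤 := by
  obtain ⟨e', x, y, z, -, hN, hxy, hyz, hxz, -⟩ := exists_milnor_frame e hh hR
  have hb : ∀ i, ⁅e' (i + 1), e' (i + 2)⁆ = (![x, y, z] i) • e' i := by
    intro i
    apply e'.repr.injective
    ext k
    have := congrFun (congrFun hN k) i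
    simp only [dualStructure, of_apply, structureConst] at this
    rw [this]
    by_cases hki : k = i
    · subst hki; simp
    · simp [hki]
  obtain ⟨c₀, c₁, c₂, h₀, h₁, h₂, hx, hy, hz⟩ := exists_rescaling hxy hyz
  have hc0 : ∀ i, ![c₀, c₁, c₂] i ≠ 0 := by
    intro i
    fin_cases i <;> simpa
  have hc : ∀ i, ![c₀, c₁, c₂] (i + 2) * (![c₀, c₁, c₂] (i + 1) * ![x, y, z] i)
      = ![c₀, c₁, c₂] i := by
    intro i
    fin_cases i
    · simpa [mul_assoc, mul_left_comm] using hx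
    · simpa [mul_assoc, mul_left_comm] using hy
    · simpa [mul_assoc, mul_left_comm] using hz
  rw [isTypeIX_iff]
  refine ⟨e'.isUnitSMul (w := ![c₀, c₁, c₂]) fun i => (hc0 i).isUnit, fun i => ?_⟩
  simp only [Module.Basis.isUnitSMul_apply, smul_lie, lie_smul, hb, smul_smul]
  rw [hc]

/-- Only Lie algebras of type IX have left-invariant metrics of positive scalar curvature. -/
theorem spatialCurvature_nonpos (hIX : ¬ IsTypeIX 𝔤) (e : Module.Basis (Fin 3) ℝ 𝔤)
    {h : Matrix (Fin 3) (Fin 3) ℝ} (hh : h.PosDef) : spatialCurvature e h ≤ 0 :=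
  not_lt.1 fun hR => hIX (isTypeIX_of_spatialCurvature_pos e hh hR)

/-- In a Milnor frame R is at most each of 2xy, 2yz, 2xz, so R³ ≤ 8(xyz)², and (xyz)² =
det(N)²/det(h) is frame independent. The summand 1 avoids a cube root: for R > 1 one has R ≤ R³. -/
theorem spatialCurvature_le (e : Module.Basis (Fin 3) ℝ 𝔤) {h : Matrix (Fin 3) (Fin 3) ℝ}
    (hh : h.PosDef) :
    spatialCurvature e h ≤ 1 + 8 * ((dualStructure (structureConst e)).det ^ 2 / h.det) := by
  have hdet := hh.det_pos
  rcases le_or_gt (spatialCurvature e h) 1 with h1 | h1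
  · have : 0 ≤ (dualStructure (structureConst e)).det ^ 2 / h.det := by positivity
    linarith
  obtain ⟨e', x, y, z, hA, hN, hxy, hyz, hxz, hR⟩ := exists_milnor_frame e hh (by linarith)
  have hfr := dualStructure_frameChange (frameChange_structureConst e e')
    (structureConst_antisymm e)
  have h2 := congrArg Matrix.det hA
  have h3 := congrArg Matrix.det hfr
  rw [hN] at h3
  simp only [det_mul, det_transpose, det_one, det_smul, Fintype.card_fin, det_diagonal,
    Fin.prod_univ_three] at h2 h3
  simp only [Matrix.cons_val] at h3
  set a := (e.toMatrix e').det
  set D := (dualStructure (structureConst e)).det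
  have ha : a ≠ 0 := by rintro h; simp [h] at h2
  have h4 : x * y * z = a * D := by
    have : a ^ 2 * (x * y * z) = a ^ 2 * (a * D) := by linear_combination h3
    exact mul_left_cancel₀ (pow_ne_zero 2 ha) this
  have h5 : D ^ 2 / h.det = (x * y * z) ^ 2 := by
    rw [h4, div_eq_iff hdet.ne']
    linear_combination -D ^ 2 * h2
  rw [h5]
  have b1 : spatialCurvature e h ≤ 2 * (x * y) := by
    rw [hR]; nlinarith [sq_nonneg (x + y - z)]
  have b2 : spatialCurvature e h ≤ 2 * (y * z) := by
    rw [hR]; nlinarith [sq_nonneg (y + z - x)]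
  have b3 : spatialCurvature e h ≤ 2 * (x * z) := by
    rw [hR]; nlinarith [sq_nonneg (x + z - y)]
  generalize spatialCurvature e h = R at *
  have c1 : R * R ≤ 2 * (x * y) * (2 * (y * z)) := mul_le_mul b1 b2 (by linarith) (by linarith)
  have c2 : R * R * R ≤ 2 * (x * y) * (2 * (y * z)) * (2 * (x * z)) :=
    mul_le_mul c1 b3 (by linarith) (by positivity)
  have c3 : R ≤ R * R * R := by nlinarith [mul_pos (sub_pos.2 h1) (sub_pos.2 h1)]
  nlinarith

/-- A constant factor in the metric changes neither the connection nor the Ricci tensor, only the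
inverse metric in the final trace. -/
theorem spatialCurvature_smul (e : Module.Basis (Fin 3) ℝ 𝔤) {h : Matrix (Fin 3) (Fin 3) ℝ}
    (hh : h.PosDef) {s : ℝ} (hs : s ≠ 0) :
    spatialCurvature e (s • h) = s⁻¹ * spatialCurvature e h := by
  have hinv : (s • h)⁻¹ = s⁻¹ • h⁻¹ := by
    have := Matrix.inv_smul' (A := h) (Units.mk0 s hs) hh.det_pos.ne'.isUnit
    simpa [Units.smul_def] using this
  have hconn : ∀ a, connMatrix (structureConst e) (s • h) a
      = connMatrix (structureConst e) h a := by
    intro a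
    have hsym : h.IsSymm := hh.isHermitian
    rw [connMatrix_eq (structureConst_antisymm e) (hsym.smul s)
      (by rw [det_smul]; exact (mul_ne_zero (pow_ne_zero _ hs) hh.det_pos.ne').isUnit),
      connMatrix_eq (structureConst_antisymm e) hsym hh.det_pos.ne'.isUnit, hinv]
    simp only [Matrix.smul_mul, Matrix.mul_smul, Matrix.smul_apply, smul_assoc, ← Finset.smul_sum,
      smul_inv_smul₀ hs]
  have hric : ricciMatrix (structureConst e) (s • h) = ricciMatrix (structureConst e) h := by
    simp only [ricciMatrix, curvMatrix, hconn]
  rw [spatialCurvature, spatialCurvature, scalarCurvature_const, scalarCurvature_const, hric, hinv]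
  simp

/-- Scalar curvatures of the left-invariant metrics of determinant `D`. -/
def curvatureSet (e : Module.Basis (Fin 3) ℝ 𝔤) (D : ℝ) : Set ℝ :=
  {r | ∃ k : Matrix (Fin 3) (Fin 3) ℝ, k.PosDef ∧ k.det = D ∧ r = spatialCurvature e k}

/-- This makes the maximal curvature a true supremum rather than the default value 0 of `sSup` on
unbounded sets. -/
theorem bddAbove_curvatureSet (e : Module.Basis (Fin 3) ℝ 𝔤) (D : ℝ) :
    BddAbove (curvatureSet e D) := by
  refine ⟨1 + 8 * ((dualStructure (structureConst e)).det ^ 2 / D), ?_⟩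
  rintro r ⟨k, hk, rfl, rfl⟩
  exact spatialCurvature_le e hk

theorem spatialCurvature_le_max (e : Module.Basis (Fin 3) ℝ 𝔤) {h : Matrix (Fin 3) (Fin 3) ℝ}
    (hh : h.PosDef) : spatialCurvature e h ≤ spatialCurvatureMax e h :=
  le_csSup (bddAbove_curvatureSet e h.det) ⟨h, hh, rfl, rfl⟩

theorem curvatureSet_smul (e : Module.Basis (Fin 3) ℝ 𝔤) {s : ℝ} (hs : 0 < s) (D : ℝ) :
    curvatureSet e (s ^ 3 * D) = s⁻¹ • curvatureSet e D := by
  ext r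
  rw [Set.mem_smul_set]
  constructor
  · rintro ⟨k, hk, hd, rfl⟩
    refine ⟨_, ⟨s⁻¹ • k, hk.smul (inv_pos.2 hs), ?_, rfl⟩, ?_⟩
    · rw [det_smul, hd, Fintype.card_fin]
      field_simp
    · rw [spatialCurvature_smul e hk (inv_ne_zero hs.ne'), smul_eq_mul, inv_inv,
        inv_mul_cancel_left₀ hs.ne']
  · rintro ⟨_, ⟨k, hk, rfl, rfl⟩, rfl⟩
    refine ⟨s • k, hk.smul hs, by rw [det_smul, Fintype.card_fin], ?_⟩
    rw [spatialCurvature_smul e hk hs.ne', smul_eq_mul]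

/-- Rescaling by s = det(h)^(1/3) reduces to determinant 1, since in dimension three the determinant
scales by s³ and the curvature by 1/s. All time dependence of the maximum thus sits in the
determinant. -/
theorem spatialCurvatureMax_eq (e : Module.Basis (Fin 3) ℝ 𝔤) {h : Matrix (Fin 3) (Fin 3) ℝ}
    (hh : h.PosDef) :
    spatialCurvatureMax e h = spatialCurvatureMax e 1 * h.det ^ (-(1 / 3) : ℝ) := by
  have hs : 0 < h.det ^ (1 / 3 : ℝ) := Real.rpow_pos_of_pos hh.det_pos _
  have h3 : h.det = (h.det ^ (1 / 3 : ℝ)) ^ 3 * (1 : Matrix (Fin 3) (Fin 3) ℝ).det := by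
    rw [det_one, mul_one, ← Real.rpow_natCast, ← Real.rpow_mul hh.det_pos.le]
    norm_num
  change sSup (curvatureSet e h.det) = sSup (curvatureSet e (1 : Matrix (Fin 3) (Fin 3) ℝ).det) * _
  conv_lhs => rw [h3]
  rw [curvatureSet_smul e hs, Real.sSup_smul_of_nonneg (inv_pos.2 hs).le, smul_eq_mul, mul_comm,
    Real.rpow_neg hh.det_pos.le]

theorem spatialCurvatureMax_pos (hIX : IsTypeIX 𝔤) (e : Module.Basis (Fin 3) ℝ 𝔤)
    {h : Matrix (Fin 3) (Fin 3) ℝ} (hh : h.PosDef) : 0 < spatialCurvatureMax e h := by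
  obtain ⟨f, hf⟩ := isTypeIX_iff.1 hIX
  -- For the round metric N = 1, and the curvature is 9/2 - 3 = 3/2. This metric is then expressed
  -- in the basis `e`; its determinant there is immaterial, as the maximum keeps its sign when the
  -- determinant changes.
  have hone : 0 < spatialCurvature f 1 := by
    rw [spatialCurvature_one, structureConst_eq_of_lie hf]
    simp [Matrix.trace]
    norm_num
  obtain ⟨k, hk, hkR⟩ : ∃ k : Matrix (Fin 3) (Fin 3) ℝ, k.PosDef ∧ 0 < spatialCurvature e k := by
    refine ⟨(f.toMatrix e)ᵀ * 1 * f.toMatrix e, ?_, ?_⟩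
    · refine (Matrix.PosDef.one (n := Fin 3) (R := ℝ)).conjTranspose_mul_mul_same
        (B := f.toMatrix e) ?_
      intro x y hxy
      have h2 := congrArg (e.toMatrix f).mulVec hxy
      simpa [Module.Basis.toMatrix_mul_toMatrix_flip] using h2
    · rwa [spatialCurvature_basis f e Matrix.PosDef.one]
  have h1 : 0 < spatialCurvatureMax e k := hkR.trans_le (spatialCurvature_le_max e hk)
  rw [spatialCurvatureMax_eq e hk] at h1
  rw [spatialCurvatureMax_eq e hh]
  exact mul_pos ((mul_pos_iff_of_pos_right (Real.rpow_pos_of_pos hk.det_pos _)).1 h1)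
    (Real.rpow_pos_of_pos hh.det_pos _)

end Curvature

/-! ### Derivatives of inverses and determinants -/

section MatrixCalculus

open Matrix

variable {n : Type*} [Fintype n] [DecidableEq n]

theorem differentiableAt_det {A : ℝ → Matrix n n ℝ} {t : ℝ}
    (hA : ∀ i j, DifferentiableAt ℝ (fun s => A s i j) t) :
    DifferentiableAt ℝ (fun s => (A s).det) t := by
  simp only [Matrix.det_apply']
  refine DifferentiableAt.fun_sum fun σ _ => DifferentiableAt.const_mul ?_ _
  exact DifferentiableAt.fun_finsetProd fun i _ => hA _ _

theorem differentiableAt_inv {A : ℝ → Matrix n n ℝ} {t : ℝ}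
    (hA : ∀ i j, DifferentiableAt ℝ (fun s => A s i j) t) (ht : (A t).det ≠ 0) (i j : n) :
    DifferentiableAt ℝ (fun s => (A s)⁻¹ i j) t := by
  simp only [Matrix.inv_def, Ring.inverse_eq_inv, Matrix.smul_apply, smul_eq_mul,
    Matrix.adjugate_apply]
  refine ((differentiableAt_det hA).inv ht).mul (differentiableAt_det fun k l => ?_)
  by_cases h : k = j
  · subst h; simp
  · simpa [Matrix.updateRow_ne h] using hA k l

theorem hasDerivAt_inv {A : ℝ → Matrix n n ℝ} {A' : Matrix n n ℝ} {t : ℝ}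
    (hA : ∀ i j, HasDerivAt (fun s => A s i j) (A' i j) t) (ht : (A t).det ≠ 0) (i j : n) :
    HasDerivAt (fun s => (A s)⁻¹ i j) ((-((A t)⁻¹ * A' * (A t)⁻¹)) i j) t := by
  have hd := fun i j =>
    (differentiableAt_inv (fun i j => (hA i j).differentiableAt) ht i j).hasDerivAt
  set B : Matrix n n ℝ := of fun i j => deriv (fun s => (A s)⁻¹ i j) t with hB
  have hcont : ∀ᶠ s in 𝓝 t, (A s).det ≠ 0 :=
    (differentiableAt_det fun i j => (hA i j).differentiableAt).continuousAt.eventually_ne ht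
  -- Differentiability of the inverse is known from cofactors, so its derivative can be read off by
  -- differentiating A⁻¹ A = 1.
  have h1 : B * A t + (A t)⁻¹ * A' = 0 := by
    ext i j
    have h2 : HasDerivAt (fun s => ∑ k, (A s)⁻¹ i k * A s k j)
        (∑ k, (B i k * A t k j + (A t)⁻¹ i k * A' k j)) t :=
      HasDerivAt.fun_sum fun k _ => (hd i k).mul (hA k j)
    have h3 : (fun s => ∑ k, (A s)⁻¹ i k * A s k j) =ᶠ[𝓝 t] fun _ => (1 : Matrix n n ℝ) i j := by
      filter_upwards [hcont] with s hs
      rw [← Matrix.mul_apply, Matrix.nonsing_inv_mul _ hs.isUnit]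
    have h4 := h2.unique ((hasDerivAt_const t _).congr_of_eventuallyEq h3)
    rw [Finset.sum_add_distrib] at h4
    simpa [Matrix.mul_apply] using h4
  have h5 : B = -((A t)⁻¹ * A' * (A t)⁻¹) := by
    have h6 := congrArg (· * (A t)⁻¹) (eq_neg_of_add_eq_zero_left h1)
    simpa [Matrix.mul_assoc, Matrix.mul_nonsing_inv _ ht.isUnit] using h6
  have := hd i j
  rwa [show deriv (fun s => (A s)⁻¹ i j) t = B i j from rfl, h5] at this

theorem hasDerivAt_det_fin_three {A : ℝ → Matrix (Fin 3) (Fin 3) ℝ} {A' : Matrix (Fin 3) (Fin 3) ℝ}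
    {t : ℝ} (hA : ∀ i j, HasDerivAt (fun s => A s i j) (A' i j) t) (ht : (A t).det ≠ 0) :
    HasDerivAt (fun s => (A s).det) ((A t).det * ((A t)⁻¹ * A').trace) t := by
  have h1 : (A t).det * ((A t)⁻¹ * A').trace = (adjugate (A t) * A').trace := by
    rw [Matrix.inv_def, Ring.inverse_eq_inv, Matrix.smul_mul, Matrix.trace_smul, smul_eq_mul,
      mul_inv_cancel_left₀ ht]
  rw [h1]
  simp only [Matrix.det_fin_three]
  have := ((((((hA 0 0).mul (hA 1 1)).mul (hA 2 2)).sub (((hA 0 0).mul (hA 1 2)).mul (hA 2 1))).sub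
    (((hA 0 1).mul (hA 1 0)).mul (hA 2 2))).add (((hA 0 1).mul (hA 1 2)).mul (hA 2 0))).add
    (((hA 0 2).mul (hA 1 0)).mul (hA 2 1)) |>.sub (((hA 0 2).mul (hA 1 1)).mul (hA 2 0))
  refine this.congr_deriv ?_
  simp only [Pi.mul_apply, Matrix.trace, diag_apply, Matrix.mul_apply, Fin.sum_univ_three]
  rw [adjugate_fin_three]
  simp
  ring

end MatrixCalculus

/-! ### Connection coefficients of the spacetime -/

section Spacetime

open Matrix

theorem spacetimeMetric_inv {h : ℝ → Matrix (Fin 3) (Fin 3) ℝ} {t : ℝ} (ht : (h t).det ≠ 0) :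
    (spacetimeMetric h t)⁻¹ = fromBlocks (-1) 0 0 (h t)⁻¹ := by
  apply Matrix.inv_eq_right_inv
  rw [spacetimeMetric, Matrix.fromBlocks_multiply]
  simp [Matrix.mul_nonsing_inv _ ht.isUnit]

variable {C : Fin 3 → Fin 3 → Fin 3 → ℝ} {h : ℝ → Matrix (Fin 3) (Fin 3) ℝ} {t : ℝ}

/-- The mixed components `K^i_j` of the extrinsic curvature. -/
def mixedExtrinsic (h : ℝ → Matrix (Fin 3) (Fin 3) ℝ) (t : ℝ) : Matrix (Fin 3) (Fin 3) ℝ :=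
  (h t)⁻¹ * extrinsic h t

/-- Connection coefficients of the spacetime frame. -/
abbrev spacetimeConnection (C : Fin 3 → Fin 3 → Fin 3 → ℝ) (h : ℝ → Matrix (Fin 3) (Fin 3) ℝ) :=
  connection (spacetimeStructure C) timeDirection (spacetimeMetric h)

/-- In the names that follow, the first letter is the upper index, the second the direction of
differentiation, the third the differentiated vector; `n` is the time direction. What survives is
K_{ij}, K^i_j and the connection of the slice. -/
theorem spacetimeConnection_nnn (ht : (h t).det ≠ 0) :
    spacetimeConnection C h (.inl ()) (.inl ()) (.inl ()) t = 0 := by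
  simp only [connection, spacetimeMetric_inv ht]
  simp [spacetimeStructure, timeDirection, spacetimeMetric]

theorem spacetimeConnection_nni (ht : (h t).det ≠ 0) (i : Fin 3) :
    spacetimeConnection C h (.inl ()) (.inl ()) (.inr i) t = 0 := by
  simp only [connection, spacetimeMetric_inv ht]
  simp [spacetimeStructure, timeDirection, spacetimeMetric]

theorem spacetimeConnection_nin (ht : (h t).det ≠ 0) (i : Fin 3) :
    spacetimeConnection C h (.inl ()) (.inr i) (.inl ()) t = 0 := by
  simp only [connection, spacetimeMetric_inv ht]
  simp [spacetimeStructure, timeDirection, spacetimeMetric]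

theorem spacetimeConnection_inn (i : Fin 3) :
    spacetimeConnection C h (.inr i) (.inl ()) (.inl ()) t = 0 := by
  simp [connection, spacetimeStructure, timeDirection, spacetimeMetric]

theorem spacetimeConnection_nij (ht : (h t).det ≠ 0) (i j : Fin 3) :
    spacetimeConnection C h (.inl ()) (.inr i) (.inr j) t = extrinsic h t i j := by
  simp only [connection, spacetimeMetric_inv ht]
  simp [spacetimeStructure, timeDirection, spacetimeMetric,
    extrinsic]
  ring

theorem extrinsic_isSymm (hs : ∀ᶠ s in 𝓝 t, (h s).IsSymm) : (extrinsic h t).IsSymm := by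
  ext i j
  simp only [extrinsic, transpose_apply, of_apply]
  congr 1
  refine Filter.EventuallyEq.deriv_eq ?_
  filter_upwards [hs] with s hs using hs.apply i j

theorem spacetimeConnection_inj (ht : (h t).det ≠ 0) (hs : (extrinsic h t).IsSymm) (i j : Fin 3) :
    spacetimeConnection C h (.inr i) (.inl ()) (.inr j) t = mixedExtrinsic h t i j := by
  simp only [mixedExtrinsic, Matrix.mul_apply]
  simp only [connection, spacetimeMetric_inv ht]
  simp [spacetimeStructure, timeDirection, spacetimeMetric]
  refine Finset.sum_congr rfl fun f _ => ?_
  rw [← hs.apply, extrinsic, of_apply]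
  ring

theorem spacetimeConnection_ijn (ht : (h t).det ≠ 0) (hs : (extrinsic h t).IsSymm) (i j : Fin 3) :
    spacetimeConnection C h (.inr i) (.inr j) (.inl ()) t = mixedExtrinsic h t i j := by
  simp only [mixedExtrinsic, Matrix.mul_apply]
  simp only [connection, spacetimeMetric_inv ht]
  simp [spacetimeStructure, timeDirection, spacetimeMetric]
  refine Finset.sum_congr rfl fun f _ => ?_
  rw [← hs.apply, extrinsic, of_apply]
  ring

theorem spacetimeConnection_ijk (ht : (h t).det ≠ 0) (d a b : Fin 3) :
    spacetimeConnection C h (.inr d) (.inr a) (.inr b) t = connMatrix C (h t) a d b := by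
  simp only [connection, connMatrix, spacetimeMetric_inv ht]
  simp [spacetimeStructure, timeDirection,
    spacetimeMetric]

end Spacetime

/-! ### Ricci tensor of the spacetime and the shear -/

section Ricci

open Matrix

variable {C : Fin 3 → Fin 3 → Fin 3 → ℝ} {h : ℝ → Matrix (Fin 3) (Fin 3) ℝ} {t : ℝ}

/-- Time derivatives of the components `K_{ij}`. -/
def extrinsicDeriv (h : ℝ → Matrix (Fin 3) (Fin 3) ℝ) (t : ℝ) : Matrix (Fin 3) (Fin 3) ℝ :=
  of fun i j => deriv (fun s => extrinsic h s i j) t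

/-- A metric which is twice differentiable at `t` and nondegenerate and symmetric near `t`. -/
structure RegularAt (h : ℝ → Matrix (Fin 3) (Fin 3) ℝ) (t : ℝ) : Prop where
  det_ne : ∀ᶠ s in 𝓝 t, (h s).det ≠ 0
  symm : ∀ᶠ s in 𝓝 t, (h s).IsSymm
  diff : ∀ i j, DifferentiableAt ℝ (fun s => h s i j) t
  diff' : ∀ i j, DifferentiableAt ℝ (fun s => deriv (fun s => h s i j) s) t

namespace RegularAt

theorem ext_symm (H : RegularAt h t) : ∀ᶠ s in 𝓝 t, (extrinsic h s).IsSymm := by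
  filter_upwards [H.symm.eventually_nhds] with s hs using extrinsic_isSymm hs

theorem hasDerivAt_h (H : RegularAt h t) (i j : Fin 3) :
    HasDerivAt (fun s => h s i j) (((2 : ℝ) • extrinsic h t) i j) t := by
  have := (H.diff i j).hasDerivAt
  simpa [extrinsic, mul_div_cancel₀] using this

theorem hasDerivAt_extrinsic (H : RegularAt h t) (i j : Fin 3) :
    HasDerivAt (fun s => extrinsic h s i j) (extrinsicDeriv h t i j) t := by
  have : DifferentiableAt ℝ (fun s => extrinsic h s i j) t := by
    simpa [extrinsic] using (H.diff' i j).div_const 2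
  exact this.hasDerivAt

theorem hasDerivAt_mixed (H : RegularAt h t) (i j : Fin 3) :
    HasDerivAt (fun s => mixedExtrinsic h s i j)
      (((h t)⁻¹ * extrinsicDeriv h t
        - (2 : ℝ) • (mixedExtrinsic h t * mixedExtrinsic h t)) i j) t := by
  have h1 : HasDerivAt (fun s => ∑ k, (h s)⁻¹ i k * extrinsic h s k j) _ t :=
    HasDerivAt.fun_sum fun k _ => (hasDerivAt_inv H.hasDerivAt_h H.det_ne.self_of_nhds i k).mul
      (H.hasDerivAt_extrinsic k j)
  refine (h1.congr_of_eventuallyEq ?_).congr_deriv ?_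
  · exact Filter.Eventually.of_forall fun s => Matrix.mul_apply
  · rw [Finset.sum_add_distrib, ← Matrix.mul_apply, ← Matrix.mul_apply, ← Matrix.add_apply]
    refine congrFun (congrFun ?_ i) j
    have h2 : -((h t)⁻¹ * ((2 : ℝ) • extrinsic h t) * (h t)⁻¹) * extrinsic h t
        = -((2 : ℝ) • (mixedExtrinsic h t * mixedExtrinsic h t)) := by
      simp only [mixedExtrinsic, Matrix.mul_smul, Matrix.smul_mul, Matrix.neg_mul,
        Matrix.mul_assoc]
    rw [h2, neg_add_eq_sub]

theorem hasDerivAt_expansion (H : RegularAt h t) :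
    HasDerivAt (expansion h) (((h t)⁻¹ * extrinsicDeriv h t).trace
        - 2 * (mixedExtrinsic h t * mixedExtrinsic h t).trace) t := by
  have : HasDerivAt (fun s => ∑ i, mixedExtrinsic h s i i) _ t :=
    HasDerivAt.fun_sum fun i _ => H.hasDerivAt_mixed i i
  refine this.congr_deriv ?_
  simp [Matrix.trace, Finset.sum_sub_distrib, Finset.mul_sum]

/-- `R_{nn} = -K' - K_{ij} K^{ij}`. -/
theorem ricci_nn (H : RegularAt h t) :
    ricci (spacetimeStructure C) timeDirection (spacetimeMetric h) (.inl ()) (.inl ()) t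
      = -deriv (expansion h) t - (mixedExtrinsic h t * mixedExtrinsic h t).trace := by
  have hdet := H.det_ne.self_of_nhds
  have hsym := H.ext_symm.self_of_nhds
  have hd : ∀ i, deriv (fun s => spacetimeConnection C h (.inr i) (.inr i) (.inl ()) s) t
      = deriv (fun s => mixedExtrinsic h s i i) t := by
    intro i
    refine Filter.EventuallyEq.deriv_eq ?_
    filter_upwards [H.det_ne, H.ext_symm] with s h1 h2
    exact spacetimeConnection_ijn h1 h2 i i
  have hK : deriv (expansion h) t = ∑ i, deriv (fun s => mixedExtrinsic h s i i) t := by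
    have : HasDerivAt (fun s => ∑ i, mixedExtrinsic h s i i) _ t :=
      HasDerivAt.fun_sum fun i _ => (H.hasDerivAt_mixed i i).differentiableAt.hasDerivAt
    exact this.deriv
  simp only [ricci, riemann, Fintype.sum_sum_type, Finset.univ_unique, Finset.sum_singleton,
    PUnit.default_eq_unit, hd, spacetimeConnection_nnn hdet, spacetimeConnection_nni hdet,
    spacetimeConnection_nin hdet, spacetimeConnection_inn, spacetimeConnection_ijn hdet hsym,
    spacetimeConnection_inj hdet hsym, hK]
  simp [timeDirection, spacetimeStructure, Matrix.trace, Matrix.mul_apply, Finset.sum_add_distrib,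
    sub_eq_add_neg]

/-- The term K' comes from differentiating Γ^n_{ji}, the trace term from Γ^a_{an}, and the quadratic
term from the mixed products. The order `j i` is the one the contraction yields. -/
theorem ricci_ij (H : RegularAt h t) (i j : Fin 3) :
    ricci (spacetimeStructure C) timeDirection (spacetimeMetric h) (.inr i) (.inr j) t
      = ricciMatrix C (h t) i j + extrinsicDeriv h t j i
        + (mixedExtrinsic h t).trace * extrinsic h t j i
        - 2 * (extrinsic h t * mixedExtrinsic h t) j i := by
  have hdet := H.det_ne.self_of_nhds
  have hsym := H.ext_symm.self_of_nhds
  have hd : deriv (fun s => spacetimeConnection C h (.inl ()) (.inr j) (.inr i) s) t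
      = extrinsicDeriv h t j i := by
    refine Filter.EventuallyEq.deriv_eq ?_
    filter_upwards [H.det_ne] with s h1
    exact spacetimeConnection_nij h1 j i
  have hT : ∑ m, mixedExtrinsic h t m j * extrinsic h t m i
      = (extrinsic h t * mixedExtrinsic h t) j i := by
    have h1 : extrinsic h t * mixedExtrinsic h t = (mixedExtrinsic h t)ᵀ * extrinsic h t := by
      rw [mixedExtrinsic, Matrix.transpose_mul, Matrix.transpose_nonsing_inv,
        H.symm.self_of_nhds.eq, hsym.eq, Matrix.mul_assoc]
    rw [h1]
    rfl
  simp only [ricci, riemann, Fintype.sum_sum_type, Finset.univ_unique, Finset.sum_singleton,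
    PUnit.default_eq_unit, hd, spacetimeConnection_nnn hdet, spacetimeConnection_nni hdet,
    spacetimeConnection_nin hdet, spacetimeConnection_ijn hdet hsym,
    spacetimeConnection_inj hdet hsym, spacetimeConnection_nij hdet, spacetimeConnection_ijk hdet]
  simp [timeDirection, spacetimeStructure, ricciMatrix, curvMatrix, Finset.sum_add_distrib,
    Finset.sum_sub_distrib, Matrix.sum_apply, Matrix.trace, Finset.sum_mul, hT]
  simp [Matrix.mul_apply]
  ring

/-- `h^{ij} R_{ij} = ³R + K' + K²`. -/
theorem trace_ricci (H : RegularAt h t) :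
    ∑ i, ∑ j, (h t)⁻¹ i j
        * ricci (spacetimeStructure C) timeDirection (spacetimeMetric h) (.inr i) (.inr j) t
      = scalarCurvature C 0 (fun _ => h t) 0 + deriv (expansion h) t + expansion h t ^ 2 := by
  have e1 : ∀ X : Matrix (Fin 3) (Fin 3) ℝ, ∑ i, ∑ j, (h t)⁻¹ i j * X j i
      = ((h t)⁻¹ * X).trace := by
    intro X
    simp [Matrix.trace, Matrix.mul_apply]
  have e2 : scalarCurvature C 0 (fun _ => h t) 0
      = ∑ i, ∑ j, (h t)⁻¹ i j * ricciMatrix C (h t) i j := by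
    simp [scalarCurvature, ricci_const]
  simp only [H.ricci_ij, mul_sub, mul_add, Finset.sum_add_distrib, Finset.sum_sub_distrib, ← e2,
    H.hasDerivAt_expansion.deriv]
  have e3 : ∑ i, ∑ j, (h t)⁻¹ i j * ((mixedExtrinsic h t).trace * extrinsic h t j i)
      = expansion h t ^ 2 := by
    simp only [mul_left_comm _ (mixedExtrinsic h t).trace, ← Finset.mul_sum, e1]
    rw [sq]; rfl
  have e4 : ∑ i, ∑ j, (h t)⁻¹ i j * (2 * (extrinsic h t * mixedExtrinsic h t) j i)
      = 2 * (mixedExtrinsic h t * mixedExtrinsic h t).trace := by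
    simp only [mul_left_comm _ (2 : ℝ), ← Finset.mul_sum, e1]
    rw [← Matrix.mul_assoc]; rfl
  rw [e1, e3, e4]
  ring

theorem scalarCurvature_eq (H : RegularAt h t) :
    scalarCurvature (spacetimeStructure C) timeDirection (spacetimeMetric h) t
      = -ricci (spacetimeStructure C) timeDirection (spacetimeMetric h) (.inl ()) (.inl ()) t
        + ∑ i, ∑ j, (h t)⁻¹ i j
          * ricci (spacetimeStructure C) timeDirection (spacetimeMetric h) (.inr i) (.inr j) t := by
  rw [scalarCurvature, spacetimeMetric_inv H.det_ne.self_of_nhds]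
  simp

theorem waveOp_eq (H : RegularAt h t) (φ : ℝ → ℝ) :
    waveOp (spacetimeStructure C) timeDirection (spacetimeMetric h) φ t
      = -deriv (deriv φ) t - expansion h t * deriv φ t := by
  have hdet := H.det_ne.self_of_nhds
  have hsym := H.ext_symm.self_of_nhds
  rw [waveOp, spacetimeMetric_inv hdet]
  simp only [Fintype.sum_sum_type, Finset.univ_unique, Finset.sum_singleton,
    PUnit.default_eq_unit, spacetimeConnection_nnn hdet, spacetimeConnection_nij hdet]
  simp [timeDirection, expansion, Matrix.trace, Matrix.mul_apply, Finset.sum_mul]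
  rw [sub_eq_add_neg]
  congr 2
  refine Finset.sum_congr rfl fun i _ => Finset.sum_congr rfl fun j _ => ?_
  rw [hsym.apply, mul_assoc]

theorem trace_inv_mul (H : RegularAt h t) : ∑ i, ∑ j, (h t)⁻¹ i j * h t i j = 3 := by
  have h1 : ((h t)⁻¹ * (h t)ᵀ).trace = 3 := by
    rw [H.symm.self_of_nhds.eq, Matrix.nonsing_inv_mul _ H.det_ne.self_of_nhds.isUnit]
    simp
  simpa [Matrix.trace, Matrix.mul_apply] using h1

/-- `2 σ² = K_{ij} K^{ij} - K² / 3`. -/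
theorem shearSq_eq (H : RegularAt h t) :
    2 * shearSq h t = (mixedExtrinsic h t * mixedExtrinsic h t).trace - expansion h t ^ 2 / 3 := by
  have h1 : (h t)⁻¹ * shear h t = mixedExtrinsic h t - (expansion h t / 3) • 1 := by
    rw [shear, Matrix.mul_sub, Matrix.mul_smul,
      Matrix.nonsing_inv_mul _ H.det_ne.self_of_nhds.isUnit]
    rfl
  have h2 : (mixedExtrinsic h t).trace = expansion h t := rfl
  rw [shearSq, h1]
  simp only [Matrix.mul_sub, Matrix.sub_mul, Matrix.mul_smul, Matrix.smul_mul, Matrix.mul_one,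
    Matrix.one_mul, Matrix.trace_sub, Matrix.trace_smul, Matrix.trace_one, h2, smul_eq_mul,
    Fintype.card_fin]
  push_cast
  ring

/-- In an orthonormal frame the shear is a symmetric matrix B, and σ² is half the trace of B Bᵀ, a
sum of squares. -/
theorem shearSq_nonneg (H : RegularAt h t) (hpos : (h t).PosDef) : 0 ≤ shearSq h t := by
  obtain ⟨A, hA⟩ := exists_transpose_mul_mul_eq_one hpos
  have hsymm : (shear h t).IsSymm := by
    have := H.ext_symm.self_of_nhds
    have h2 := H.symm.self_of_nhds
    exact this.sub (h2.smul _)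
  have hinv : (h t)⁻¹ = A * Aᵀ := by
    have h1 : A * (Aᵀ * h t) = 1 := by
      rw [mul_eq_one_comm, hA]
    rw [← Matrix.mul_assoc] at h1
    exact Matrix.inv_eq_left_inv h1
  have h3 : ((h t)⁻¹ * shear h t * ((h t)⁻¹ * shear h t)).trace
      = ((Aᵀ * shear h t * A) * (Aᵀ * shear h t * A)ᵀ).trace := by
    rw [hinv, Matrix.trace_mul_comm]
    simp only [Matrix.transpose_mul, Matrix.transpose_transpose, hsymm.eq, Matrix.mul_assoc]
    conv_rhs => rw [Matrix.trace_mul_comm]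
    conv_lhs => rw [Matrix.trace_mul_comm]
    simp only [Matrix.mul_assoc]
    conv_lhs => rw [Matrix.trace_mul_comm]
    simp only [Matrix.mul_assoc]
  rw [shearSq, h3]
  refine mul_nonneg (by norm_num) ?_
  simp only [Matrix.trace, diag_apply, Matrix.mul_apply (M := Aᵀ * shear h t * A), transpose_apply]
  exact Finset.sum_nonneg fun i _ => Finset.sum_nonneg fun j _ => mul_self_nonneg _

end RegularAt
end Ricci

/-! ### Evolution equations of a Bianchi model -/

namespace BianchiModel

open Matrix

variable {α : ℝ} {𝔤 : Type*} [LieRing 𝔤] [LieAlgebra ℝ 𝔤] {e : Module.Basis (Fin 3) ℝ 𝔤}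
  (M : BianchiModel α e) {t : ℝ}

theorem regularAt (ht : t ∈ M.J) : RegularAt M.h t where
  det_ne := by
    filter_upwards [M.isOpen_J.mem_nhds ht] with s hs using (M.posDef_h s hs).det_pos.ne'
  symm := by
    filter_upwards [M.isOpen_J.mem_nhds ht] with s hs using (M.posDef_h s hs).isHermitian
  diff i j := ((M.contDiff_h i j).differentiableOn (by norm_num)).differentiableAt
    (M.isOpen_J.mem_nhds ht)
  diff' i j := (((contDiffOn_succ_iff_deriv_of_isOpen (n := 1) M.isOpen_J).1
    (by simpa [one_add_one_eq_two] using M.contDiff_h i j)).2.2.differentiableOn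
      (by norm_num)).differentiableAt (M.isOpen_J.mem_nhds ht)

theorem hasDerivAt_φ (ht : t ∈ M.J) : HasDerivAt M.φ (deriv M.φ t) t :=
  ((M.contDiff_φ.differentiableOn (by norm_num)).differentiableAt
    (M.isOpen_J.mem_nhds ht)).hasDerivAt

/-- `φ'' + K φ' + V'(φ) = 0`. -/
theorem hasDerivAt_deriv_φ (ht : t ∈ M.J) :
    HasDerivAt (deriv M.φ) (-(M.K t * deriv M.φ t) - deriv (potential α) (M.φ t)) t := by
  have h1 : DifferentiableAt ℝ (deriv M.φ) t :=
    (((contDiffOn_succ_iff_deriv_of_isOpen (n := 1) M.isOpen_J).1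
      (by simpa [one_add_one_eq_two] using M.contDiff_φ)).2.2.differentiableOn
        (by norm_num)).differentiableAt (M.isOpen_J.mem_nhds ht)
  have h2 := M.scalar_eq t ht
  rw [(M.regularAt ht).waveOp_eq] at h2
  refine h1.hasDerivAt.congr_deriv ?_
  rw [K]
  linarith

theorem fluid_scalar_nn (ht : t ∈ M.J) :
    scalarStress α M.h M.φ (.inl ()) (.inl ()) t + fluidStress M.h M.ρ M.p (.inl ()) (.inl ()) t
      = M.E t + M.ρ t := by
  rw [scalarStress, spacetimeMetric_inv (M.regularAt ht).det_ne.self_of_nhds]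
  simp [fluidStress, spacetimeMetric, timeDirection, E]
  ring

theorem fluid_scalar_ij (ht : t ∈ M.J) (i j : Fin 3) :
    scalarStress α M.h M.φ (.inr i) (.inr j) t + fluidStress M.h M.ρ M.p (.inr i) (.inr j) t
      = M.h t i j * (1 / 2 * deriv M.φ t ^ 2 - potential α (M.φ t) + M.p t) := by
  rw [scalarStress, spacetimeMetric_inv (M.regularAt ht).det_ne.self_of_nhds]
  simp [fluidStress, spacetimeMetric, timeDirection]
  ring

/-- Two scalar equations suffice: the nn component is the constraint, and combining it with the
spatial trace isolates R_{nn}, which contains K'. -/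
theorem field_equations (ht : t ∈ M.J) :
    M.R3 t + M.K t ^ 2 - (mixedExtrinsic M.h t * mixedExtrinsic M.h t).trace
        = 2 * (M.E t + M.ρ t) ∧
      -deriv M.K t - (mixedExtrinsic M.h t * mixedExtrinsic M.h t).trace
        = deriv M.φ t ^ 2 - potential α (M.φ t) + (M.ρ t + 3 * M.p t) / 2 := by
  have H := M.regularAt ht
  have h1 := M.einstein_eq t ht (.inl ()) (.inl ())
  rw [M.fluid_scalar_nn ht, einstein, H.scalarCurvature_eq, H.trace_ricci, H.ricci_nn] at h1
  have h2 : ∑ i, ∑ j, (M.h t)⁻¹ i j * einstein (spacetimeStructure (structureConst e))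
      timeDirection (spacetimeMetric M.h) (.inr i) (.inr j) t
      = 3 * (1 / 2 * deriv M.φ t ^ 2 - potential α (M.φ t) + M.p t) := by
    simp only [M.einstein_eq t ht, M.fluid_scalar_ij ht, ← mul_assoc, ← Finset.sum_mul,
      H.trace_inv_mul]
  have h3 : ∀ i j, spacetimeMetric M.h t (.inr i) (.inr j) = M.h t i j := fun i j => rfl
  simp only [einstein, h3, mul_sub, Finset.sum_sub_distrib, H.trace_ricci,
    mul_left_comm _ (1 / 2 * scalarCurvature (spacetimeStructure (structureConst e)) timeDirection
      (spacetimeMetric M.h) t), ← Finset.mul_sum, H.trace_inv_mul] at h2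
  rw [H.scalarCurvature_eq, H.trace_ricci, H.ricci_nn] at h2
  have h4 : spacetimeMetric M.h t (.inl ()) (.inl ()) = -1 := by simp [spacetimeMetric]
  rw [h4] at h1
  have e1 : M.K = expansion M.h := rfl
  have e2 : M.R3 t = scalarCurvature (structureConst e) 0 (fun _ => M.h t) 0 := rfl
  rw [e1, e2]
  have e3 : M.E t = 1 / 2 * deriv M.φ t ^ 2 + potential α (M.φ t) := rfl
  rw [e3] at h1 ⊢
  constructor <;> linarith

theorem hasDerivAt_K' (ht : t ∈ M.J) : HasDerivAt M.K (deriv M.K t) t :=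
  (M.regularAt ht).hasDerivAt_expansion.differentiableAt.hasDerivAt

theorem σsq_nonneg (ht : t ∈ M.J) : 0 ≤ M.σsq t :=
  (M.regularAt ht).shearSq_nonneg (M.posDef_h t ht)

theorem ρ_nonneg (ht : t ∈ M.J) : 0 ≤ M.ρ t := (abs_nonneg _).trans (M.dominant_energy t ht)

/-- The Hamiltonian constraint. -/
theorem S_eq (ht : t ∈ M.J) : M.S t = M.σsq t + M.ρ t - M.R3 t / 2 := by
  have h1 := (M.field_equations ht).1
  have h2 := (M.regularAt ht).shearSq_eq
  change 2 * M.σsq t = _ - M.K t ^ 2 / 3 at h2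
  rw [S]
  linarith

/-- The Raychaudhuri equation. -/
theorem hasDerivAt_K (ht : t ∈ M.J) :
    HasDerivAt M.K (-(M.K t ^ 2 / 3) - 2 * M.σsq t - deriv M.φ t ^ 2 + potential α (M.φ t)
      - (M.ρ t + 3 * M.p t) / 2) t := by
  have h1 := (M.field_equations ht).2
  have h2 := (M.regularAt ht).shearSq_eq
  change 2 * M.σsq t = _ - M.K t ^ 2 / 3 at h2
  refine (M.hasDerivAt_K' ht).congr_deriv ?_
  linarith

theorem differentiable_potential : Differentiable ℝ (potential α) := by
  unfold potential
  fun_prop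

theorem hasDerivAt_E (ht : t ∈ M.J) : HasDerivAt M.E (-(M.K t * deriv M.φ t ^ 2)) t := by
  have h1 := ((M.hasDerivAt_deriv_φ ht).pow 2).const_mul (1 / 2)
  have h2 := (differentiable_potential (α := α) (M.φ t)).hasDerivAt.comp t (M.hasDerivAt_φ ht)
  refine (h1.add h2).congr_deriv ?_
  ring

/-- The scalar field drops out: writing K²/3 as S + E in the Raychaudhuri equation leaves -K φ'²,
which cancels -E'. -/
theorem hasDerivAt_S (ht : t ∈ M.J) :
    HasDerivAt M.S (-(2 / 3) * M.K t * (M.S t + 2 * M.σsq t + (M.ρ t + 3 * M.p t) / 2)) t := by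
  have h1 := ((M.hasDerivAt_K ht).pow 2).const_mul (1 / 3)
  refine (h1.sub (M.hasDerivAt_E ht)).congr_deriv ?_
  rw [S, E]
  ring

/-- Since det(h)' = 2K det(h), the power -1/3 decays at the rate (2/3) K. -/
theorem hasDerivAt_R3max (ht : t ∈ M.J) :
    HasDerivAt M.R3max (-(2 / 3) * M.K t * M.R3max t) t := by
  have hdet := (M.posDef_h t ht).det_pos
  have H := M.regularAt ht
  have h1 : HasDerivAt (fun s => (M.h s).det) ((M.h t).det * (2 * M.K t)) t := by
    refine (hasDerivAt_det_fin_three H.hasDerivAt_h hdet.ne').congr_deriv ?_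
    rw [Matrix.mul_smul, Matrix.trace_smul]
    rfl
  have h2 := (h1.rpow_const (p := (-(1 / 3) : ℝ)) (Or.inl hdet.ne')).const_mul
    (spatialCurvatureMax e 1)
  refine (h2.congr_of_eventuallyEq ?_).congr_deriv ?_
  · filter_upwards [M.isOpen_J.mem_nhds ht] with s hs using
      spatialCurvatureMax_eq e (M.posDef_h s hs)
  · rw [R3max, spatialCurvatureMax_eq e (M.posDef_h t ht), Real.rpow_sub_one hdet.ne']
    field_simp

end BianchiModel

/-! ### Differential inequalities and elementary estimates -/

section Inequalities

theorem le_of_hasDerivAt_nonpos {a b : ℝ} (hab : a ≤ b) {f f' : ℝ → ℝ}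
    (hf : ∀ s ∈ Icc a b, HasDerivAt f (f' s) s) (hf' : ∀ s ∈ Icc a b, f' s ≤ 0) : f b ≤ f a := by
  have : AntitoneOn f (Icc a b) := by
    refine antitoneOn_of_deriv_nonpos (convex_Icc a b)
      (fun s hs => (hf s hs).continuousAt.continuousWithinAt)
      (fun s hs => (hf s (interior_subset hs)).differentiableAt.differentiableWithinAt)
      fun s hs => ?_
    rw [(hf s (interior_subset hs)).deriv]
    exact hf' s (interior_subset hs)
  exact this (left_mem_Icc.2 hab) (right_mem_Icc.2 hab) hab

/-- A linear differential inequality preserves nonpositivity. -/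
theorem nonpos_of_hasDerivAt_le {a b : ℝ} (hab : a ≤ b) {f f' c : ℝ → ℝ}
    (hf : ∀ s ∈ Icc a b, HasDerivAt f (f' s) s) (hc : ContinuousOn c (Icc a b))
    (hf' : ∀ s ∈ Icc a b, f' s ≤ c s * f s) (h0 : f a ≤ 0) : f b ≤ 0 := by
  -- The coefficient is extended continuously to the whole line so that the integrating factor
  -- exp(-∫c) is differentiable at the endpoints too.
  let c' : ℝ → ℝ := IccExtend hab ((Icc a b).domRestrict c)
  have hc' : Continuous c' := hc.domRestrict.Icc_extend'
  have hcc : ∀ s ∈ Icc a b, c' s = c s := fun s hs => by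
    simp only [c', IccExtend_of_mem hab _ hs]
    rfl
  have hA : ∀ s, HasDerivAt (fun u => ∫ x in a..u, c' x) (c' s) s := fun s =>
    intervalIntegral.integral_hasDerivAt_right (hc'.intervalIntegrable _ _)
      (hc'.stronglyMeasurableAtFilter _ _) hc'.continuousAt
  have key := le_of_hasDerivAt_nonpos hab
    (f := fun s => f s * exp (-∫ x in a..s, c' x))
    (fun s hs => (hf s hs).mul (hA s).neg.exp) fun s hs => by
      rw [hcc s hs, Pi.neg_apply]
      nlinarith [mul_nonneg (sub_nonneg.2 (hf' s hs)) (exp_pos (-∫ x in a..s, c' x)).le]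
  have h1 : f a * exp (-∫ x in a..a, c' x) ≤ 0 :=
    mul_nonpos_of_nonpos_of_nonneg h0 (exp_pos _).le
  exact nonpos_of_mul_nonpos_left (key.trans h1) (exp_pos _)

/-- The function f = X sinh - m cosh satisfies f' ≤ -X f and f(a) = -m ≤ 0. This form of X ≤ m coth
avoids the singularity of coth at the initial time. -/
theorem riccati_bound {a b m : ℝ} (hab : a ≤ b) (hm : 0 ≤ m) {X X' : ℝ → ℝ}
    (hX : ∀ s ∈ Icc a b, HasDerivAt X (X' s) s)
    (hX' : ∀ s ∈ Icc a b, X' s ≤ m ^ 2 - X s ^ 2) :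
    X b * sinh (m * (b - a)) ≤ m * cosh (m * (b - a)) := by
  have hlin : ∀ s, HasDerivAt (fun s => m * (s - a)) m s := fun s => by
    simpa using ((hasDerivAt_id s).sub_const a).const_mul m
  have key := nonpos_of_hasDerivAt_le hab
    (f := fun s => X s * sinh (m * (s - a)) - m * cosh (m * (s - a)))
    (c := fun s => -X s)
    (fun s hs => ((hX s hs).mul (hlin s).sinh).sub ((hlin s).cosh.const_mul m))
    (fun s hs => (hX s hs).continuousAt.continuousWithinAt.neg) (fun s hs => ?_) ?_
  · linarith
  · have h1 : 0 ≤ sinh (m * (s - a)) := sinh_nonneg_iff.2 (mul_nonneg hm (sub_nonneg.2 hs.1))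
    nlinarith [mul_nonneg (sub_nonneg.2 (hX' s hs)) h1]
  · simpa using hm

/-- A continuous function which starts positive stays positive if it does not vanish as long as
it is nonnegative. -/
theorem pos_of_forall_ne_zero {a b : ℝ} {f : ℝ → ℝ} (hf : ContinuousOn f (Icc a b)) (h0 : 0 < f a)
    (h : ∀ s ∈ Icc a b, (∀ u ∈ Icc a s, 0 ≤ f u) → f s ≠ 0) : ∀ s ∈ Icc a b, 0 < f s := by
  intro s hs
  by_contra hneg
  have hzero : ∀ u ∈ Icc a b, f u ≤ 0 → ∃ v ∈ Icc a u, f v = 0 := fun u hu hu0 =>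
    intermediate_value_Icc' hu.1 (hf.mono (Icc_subset_Icc_right hu.2)) ⟨hu0, h0.le⟩
  have hcomp : IsCompact (Icc a b ∩ f ⁻¹' {0}) :=
    isCompact_Icc.of_isClosed_subset (hf.preimage_isClosed_of_isClosed isClosed_Icc
      isClosed_singleton) inter_subset_left
  obtain ⟨v, hv, hv0⟩ := hzero s hs (not_lt.1 hneg)
  -- The first zero `u`. A negative value before `u` would force a still earlier zero, so f is
  -- nonnegative up to `u`, contradicting `h`.
  obtain ⟨u, ⟨hu, hu0⟩, hmin⟩ := hcomp.exists_isLeast ⟨v, ⟨hv.1, hv.2.trans hs.2⟩, hv0⟩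
  refine h u hu (fun w hw => ?_) hu0
  by_contra hw0
  obtain ⟨x, hx, hx0⟩ := hzero w ⟨hw.1, hw.2.trans hu.2⟩ (not_le.1 hw0).le
  have h1 : u ≤ x := hmin ⟨⟨hx.1, (hx.2.trans hw.2).trans hu.2⟩, hx0⟩
  have h2 : w = u := le_antisymm hw.2 (h1.trans hx.2)
  rw [h2] at hw0
  exact hw0 (le_of_eq hu0.symm)

/-- By convexity the exponential lies below its chord on [0, 1], and exp(-2/√3) ≤ 1/3. -/
theorem exp_neg_le_one_sub {x : ℝ} (h0 : 0 ≤ x) (h1 : x ≤ 1) :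
    exp (-(x * (2 / √3))) ≤ 1 - 2 / 3 * x := by
  have h3 : exp (-(2 / √3)) ≤ 1 / 3 := by
    -- 2/√3 is about 1.1547, and four Taylor terms of exp at 1.15 already exceed 3.
    have hs : (1.15 : ℝ) ≤ 2 / √3 := by
      rw [le_div_iff₀ (by positivity)]
      nlinarith [Real.sq_sqrt (show (0 : ℝ) ≤ 3 by norm_num), Real.sqrt_nonneg 3]
    have he : (3 : ℝ) ≤ exp 1.15 := by
      have := Real.sum_le_exp_of_nonneg (x := 1.15) (by norm_num) 4
      refine le_trans ?_ this
      norm_num [Finset.sum_range_succ, Nat.factorial]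
    rw [exp_neg, ← one_div]
    exact one_div_le_one_div_of_le (by norm_num) (he.trans (exp_le_exp.2 hs))
  have := convexOn_exp.2 (mem_univ (-(2 / √3))) (mem_univ 0) h0 (sub_nonneg.2 h1) (by ring)
  simp only [smul_eq_mul, mul_zero, add_zero, exp_zero, mul_one, mul_neg] at this
  nlinarith

/-- Write u = mτ, so that u ≥ √(η/3) after one Hubble time. The chord estimate gives 1 - e^(-2u) ≥
(2/3)√η, hence sinh² u ≥ η e^(2u)/9. This η cancels the one in 3m² = ηV and leaves the constant 9.
-/
theorem rate_bound {η V τ : ℝ} (hη : 0 < η) (hη1 : η ≤ 1) (hV : 0 < V) (hτ : 1 / √V ≤ τ) :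
    3 * √(η * V / 3) ^ 2 / sinh (√(η * V / 3) * τ) ^ 2
      ≤ 9 * V * exp (-(2 * √(η * V / 3) * τ)) := by
  have hsV := Real.sqrt_pos.2 hV
  have hsη := Real.sqrt_pos.2 hη
  have hm : √(η * V / 3) = √η * √V / √3 := by
    rw [Real.sqrt_div (by positivity), Real.sqrt_mul hη.le]
  set m := √(η * V / 3) with hmdef
  have hm2 : m ^ 2 = η * V / 3 := Real.sq_sqrt (by positivity)
  have hu : √η / √3 ≤ m * τ := by
    have h1 : √η / √3 = m * (1 / √V) := by rw [hm]; field_simp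
    rw [h1]
    exact mul_le_mul_of_nonneg_left hτ (Real.sqrt_nonneg _)
  set u := m * τ
  have hu0 : 0 < u := lt_of_lt_of_le (by positivity) hu
  have h1 : 2 / 3 * √η ≤ 1 - exp (-(2 * u)) := by
    have h2 := exp_neg_le_one_sub hsη.le (Real.sqrt_le_one.2 hη1)
    have h3 : exp (-(2 * u)) ≤ exp (-(√η * (2 / √3))) := by
      apply exp_le_exp.2
      have : √η * (2 / √3) = 2 * (√η / √3) := by ring
      linarith
    linarith
  have h2 : sinh u = exp u * (1 - exp (-(2 * u))) / 2 := by
    rw [sinh_eq, mul_sub, mul_one, ← exp_add]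
    ring_nf
  have h3 : exp (2 * u) * η / 9 ≤ sinh u ^ 2 := by
    have h4 : exp u * (2 / 3 * √η) / 2 ≤ sinh u := by
      rw [h2]
      have := mul_le_mul_of_nonneg_left h1 (exp_pos u).le
      linarith
    have h5 := pow_le_pow_left₀ (by positivity) h4 2
    have h6 : (exp u * (2 / 3 * √η) / 2) ^ 2 = exp (2 * u) * η / 9 := by
      rw [two_mul u, exp_add]
      have := Real.sq_sqrt hη.le
      linear_combination exp u ^ 2 / 9 * this
    rwa [h6] at h5
  have h4 : -(2 * m * τ) = -(2 * u) := by ring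
  rw [h4, hm2, div_le_iff₀ (pow_pos (sinh_pos_iff.2 hu0) 2)]
  have h5 := mul_le_mul_of_nonneg_left h3 (show 0 ≤ 9 * V * exp (-(2 * u)) by positivity)
  have h6 : exp (-(2 * u)) * exp (2 * u) = 1 := by rw [← exp_add]; simp
  calc 3 * (η * V / 3) = 9 * V * exp (-(2 * u)) * (exp (2 * u) * η / 9) := by
        linear_combination (-(V * η)) * h6
    _ ≤ _ := h5

end Inequalities

/-! ### Elementary properties of the potential -/

section Potential

variable {α : ℝ}

theorem Vinf_pos (hα : 0 < α) : 0 < Vinf α := by unfold Vinf; positivity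

theorem potential_eq (α φ : ℝ) : potential α φ = Vinf α * (1 - exp (-√(2 / 3) * φ)) ^ 2 := rfl

theorem potential_zero : potential α 0 = 0 := by simp [potential]

theorem exp_lt_one_of_pos {φ : ℝ} (hφ : 0 < φ) : exp (-√(2 / 3) * φ) < 1 := by
  rw [exp_lt_one_iff]
  have : 0 < √(2 / 3 : ℝ) := by positivity
  nlinarith

theorem potential_lt_Vinf (hα : 0 < α) {φ : ℝ} (hφ : 0 < φ) : potential α φ < Vinf α := by
  rw [potential_eq]
  have h1 := exp_lt_one_of_pos hφ
  have h2 := exp_pos (-√(2 / 3) * φ)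
  have h3 : (1 - exp (-√(2 / 3) * φ)) ^ 2 < 1 := by nlinarith
  nlinarith [Vinf_pos hα]

theorem potential_strictMono (hα : 0 < α) {x y : ℝ} (hx : 0 ≤ x) (hxy : x < y) :
    potential α x < potential α y := by
  have hc : 0 < √(2 / 3 : ℝ) := by positivity
  have h1 : exp (-√(2 / 3) * y) < exp (-√(2 / 3) * x) := exp_lt_exp.2 (by nlinarith)
  have h2 : exp (-√(2 / 3) * x) ≤ 1 := exp_le_one_iff.2 (by nlinarith)
  rw [potential_eq, potential_eq]
  refine mul_lt_mul_of_pos_left (pow_lt_pow_left₀ (by linarith) (by linarith) (by norm_num))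
    (Vinf_pos hα)

theorem deriv_potential (φ : ℝ) : deriv (potential α) φ
    = 2 * √(2 / 3) * Vinf α * (1 - exp (-√(2 / 3) * φ)) * exp (-√(2 / 3) * φ) := by
  have h1 : HasDerivAt (fun φ : ℝ => exp (-√(2 / 3) * φ)) (exp (-√(2 / 3) * φ) * -√(2 / 3)) φ := by
    simpa using ((hasDerivAt_id φ).const_mul (-√(2 / 3))).exp
  have h2 := ((h1.const_sub 1).pow 2).const_mul (Vinf α)
  have h3 : potential α = fun φ => Vinf α * (1 - exp (-√(2 / 3) * φ)) ^ 2 := rfl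
  rw [h3]
  refine h2.deriv.trans ?_
  push_cast
  ring

theorem deriv_potential_le (hα : 0 < α) {φ : ℝ} (hφ : 0 < φ) :
    deriv (potential α) φ ≤ 2 * Vinf α := by
  have h1 := exp_lt_one_of_pos hφ
  have h2 := exp_pos (-√(2 / 3) * φ)
  have h3 : √(2 / 3 : ℝ) ≤ 1 := Real.sqrt_le_one.2 (by norm_num)
  have h4 : (1 - exp (-√(2 / 3) * φ)) * exp (-√(2 / 3) * φ) ≤ 1 := by nlinarith
  have h5 : 0 ≤ (1 - exp (-√(2 / 3) * φ)) * exp (-√(2 / 3) * φ) :=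
    mul_nonneg (by linarith) h2.le
  rw [deriv_potential, mul_assoc]
  have h6 : √(2 / 3 : ℝ) * ((1 - exp (-√(2 / 3) * φ)) * exp (-√(2 / 3) * φ)) ≤ 1 := by
    nlinarith [Real.sqrt_nonneg (2 / 3 : ℝ)]
  nlinarith [Vinf_pos hα]

theorem continuous_potential : Continuous (potential α) := by unfold potential; fun_prop

end Potential

/-! ### Estimates common to all types while the model expands -/

namespace BianchiModel

variable {α : ℝ} {𝔤 : Type*} [LieRing 𝔤] [LieAlgebra ℝ 𝔤] {e : Module.Basis (Fin 3) ℝ 𝔤}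
  (M : BianchiModel α e) {η ti t : ℝ}

theorem Icc_subset_J (hti : ti ∈ M.J) (ht : t ∈ M.J) : Icc ti t ⊆ M.J := M.ordConnected_J.out hti ht

variable {M}

theorem Inflating.mono (h : M.Inflating η ti t) {s : ℝ} (hs : s ≤ t) : M.Inflating η ti s :=
  fun u hu => h u ⟨hu.1, hu.2.trans hs⟩

/-- The potential vanishes at 0, so φ cannot cross 0 while V ≥ η V_∞ > 0. Positivity is what keeps V
below V_∞. -/
theorem Inflating.φ_pos (h : M.Inflating η ti t) (hα : 0 < α) (hη : 0 < η) (hti : ti ∈ M.J)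
    (ht : t ∈ M.J) (hφ : 0 < M.φ ti) : ∀ s ∈ Icc ti t, 0 < M.φ s := by
  have hJ := M.Icc_subset_J hti ht
  refine pos_of_forall_ne_zero (fun s hs =>
    (M.hasDerivAt_φ (hJ hs)).continuousAt.continuousWithinAt) hφ fun s hs _ h0 => ?_
  have h1 := h s hs
  rw [h0, potential_zero] at h1
  exact absurd h1 (not_le.2 (mul_pos hη (Vinf_pos hα)))

theorem potential_le_E (s : ℝ) : potential α (M.φ s) ≤ M.E s := by
  rw [E]
  linarith [sq_nonneg (deriv M.φ s)]

theorem K_sq (s : ℝ) : M.K s ^ 2 = 3 * (M.S s + M.E s) := by rw [S]; ring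

/-- `S' ≤ -(2/3) K S` while the model expands. -/
theorem deriv_S_le {s : ℝ} (hs : s ∈ M.J) (hK : 0 ≤ M.K s) :
    -(2 / 3) * M.K s * (M.S s + 2 * M.σsq s + (M.ρ s + 3 * M.p s) / 2)
      ≤ -(2 / 3) * M.K s * M.S s := by
  nlinarith [mul_nonneg hK (M.σsq_nonneg hs), mul_nonneg hK (M.strong_energy s hs)]

theorem continuousOn_K (hti : ti ∈ M.J) (ht : t ∈ M.J) : ContinuousOn M.K (Icc ti t) := fun _ hs =>
  (M.hasDerivAt_K (M.Icc_subset_J hti ht hs)).continuousAt.continuousWithinAt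

/-- Dropping the shear, kinetic and fluid terms and using V ≤ V_∞, the Raychaudhuri equation becomes
a Riccati inequality for K/3. -/
theorem expansion_le (hα : 0 < α) (hti : ti ∈ M.J) (ht : t ∈ M.J) (htt : ti < t)
    (hφ : ∀ s ∈ Icc ti t, 0 < M.φ s) :
    M.K t ≤ √(3 * Vinf α) / tanh (√(Vinf α / 3) * (t - ti)) := by
  have hV := Vinf_pos hα
  have hJ := M.Icc_subset_J hti ht
  have hm : 0 < √(Vinf α / 3) := Real.sqrt_pos.2 (by positivity)
  have key := riccati_bound htt.le hm.le (X := fun s => M.K s / 3)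
    (fun s hs => (M.hasDerivAt_K (hJ hs)).div_const 3) fun s hs => by
      rw [Real.sq_sqrt (by positivity)]
      have h1 := M.σsq_nonneg (hJ hs)
      have h2 := M.strong_energy s (hJ hs)
      have h3 := (potential_lt_Vinf hα (hφ s hs)).le
      nlinarith [sq_nonneg (deriv M.φ s)]
  have h3 : √(3 * Vinf α) = 3 * √(Vinf α / 3) := by
    rw [show 3 * Vinf α = 3 ^ 2 * (Vinf α / 3) by ring, Real.sqrt_mul (by norm_num),
      Real.sqrt_sq (by norm_num)]
  have hs : 0 < sinh (√(Vinf α / 3) * (t - ti)) :=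
    sinh_pos_iff.2 (mul_pos hm (sub_pos.2 htt))
  rw [h3, tanh_eq_sinh_div_cosh, div_div_eq_mul_div, le_div_iff₀ hs]
  linarith

theorem S_le (hα : 0 < α) (hη : 0 < η) (hti : ti ∈ M.J) (ht : t ∈ M.J) (htt : ti < t)
    (hinf : M.Inflating η ti t) (hK : ∀ s ∈ Icc ti t, 0 < M.K s) :
    M.S t ≤ 3 * rate α η ^ 2 / sinh (rate α η * (t - ti)) ^ 2 := by
  have hV := Vinf_pos hα
  have hJ := M.Icc_subset_J hti ht
  have hm : 0 < rate α η := Real.sqrt_pos.2 (by positivity)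
  have hm2 : rate α η ^ 2 = η * Vinf α / 3 := Real.sq_sqrt (by positivity)
  set m := rate α η with hmdef
  rcases le_or_gt (M.S t) 0 with h0 | h0
  · exact h0.trans (by positivity)
  -- S' ≤ -(2/3) K S means that S, once nonpositive, stays so. As S is positive at `t`, it was
  -- positive throughout.
  have hS : ∀ s ∈ Icc ti t, 0 < M.S s := by
    intro s hs
    by_contra hneg
    refine absurd h0 (not_lt.2 (nonpos_of_hasDerivAt_le (c := fun s => -(2 / 3) * M.K s) hs.2
      (fun u hu => M.hasDerivAt_S (hJ ⟨hs.1.trans hu.1, hu.2⟩)) ?_ (fun u hu => ?_)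
      (not_lt.1 hneg)))
    · exact ((continuousOn_K hti ht).mono (Icc_subset_Icc_left hs.1)).const_mul _
    · have hu' : u ∈ Icc ti t := ⟨hs.1.trans hu.1, hu.2⟩
      exact deriv_S_le (hJ hu') (hK u hu').le
  have hXsq : ∀ s ∈ Icc ti t, √(M.S s / 3 + m ^ 2) ^ 2 = M.S s / 3 + m ^ 2 := fun s hs =>
    Real.sq_sqrt (by have := hS s hs; positivity)
  have key := riccati_bound htt.le hm.le (X := fun s => √(M.S s / 3 + m ^ 2))
    (fun s hs => (((M.hasDerivAt_S (hJ hs)).div_const 3).add_const (m ^ 2)).sqrt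
      (by have := hS s hs; positivity)) fun s hs => by
      have hSs := hS s hs
      rw [hXsq s hs]
      have hX : 0 < √(M.S s / 3 + m ^ 2) := Real.sqrt_pos.2 (by positivity)
      have hX2 := hXsq s hs
      set X := √(M.S s / 3 + m ^ 2)
      -- K² = 3(S + E) ≥ 3(S + 3m²) = 9X². This turns X' ≤ -KS/(9X) into X' ≤ -S/3 = m² - X².
      have hKX : 3 * X ≤ M.K s := by
        have h1 := M.K_sq s
        have h2 := (hinf s hs).trans (M.potential_le_E s)
        exact (pow_le_pow_iff_left₀ (by positivity) (hK s hs).le two_ne_zero).1 (by nlinarith)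
      rw [div_le_iff₀ (by positivity)]
      have h3 := deriv_S_le (hJ hs) (hK s hs).le
      nlinarith [mul_le_mul_of_nonneg_right hKX hSs.le]
  have hs : 0 < sinh (m * (t - ti)) := sinh_pos_iff.2 (mul_pos hm (sub_pos.2 htt))
  -- After squaring, cosh² = sinh² + 1 cancels the m² sinh² on both sides and leaves S sinh² ≤ 3m².
  have h1 := pow_le_pow_left₀ (by positivity) key 2
  rw [mul_pow, mul_pow, hXsq t (right_mem_Icc.2 htt.le), Real.cosh_sq] at h1
  rw [le_div_iff₀ (by positivity)]
  linarith

theorem E_le (hti : ti ∈ M.J) (ht : t ∈ M.J) (hK : ∀ s ∈ Icc ti t, 0 ≤ M.K s) :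
    ∀ s ∈ Icc ti t, M.E s ≤ M.E ti := fun s hs =>
  le_of_hasDerivAt_nonpos hs.1
    (fun u hu => M.hasDerivAt_E (M.Icc_subset_J hti ht ⟨hu.1, hu.2.trans hs.2⟩)) fun u hu => by
      have := hK u ⟨hu.1, hu.2.trans hs.2⟩
      have := mul_nonneg this (sq_nonneg (deriv M.φ u))
      linarith

/-- Energy does not increase, so φ' ≥ -√G(φ), and the undamped descent time to be covered shrinks no
faster than time passes. If φ' vanishes at `ti`, the integrand is singular at the upper endpoint;
the estimate is therefore proved below `M.φ ti` and passed to the limit. -/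
theorem undampedTime_le (hα : 0 < α) (hti : ti ∈ M.J) (ht : t ∈ M.J) (htt : ti < t)
    (hφ : ∀ s ∈ Icc ti t, 0 < M.φ s) (hK : ∀ s ∈ Icc ti t, 0 ≤ M.K s) :
    M.undampedTime ti (M.φ t) ≤ t - ti := by
  have hJ := M.Icc_subset_J hti ht
  set G : ℝ → ℝ := fun y => deriv M.φ ti ^ 2 + 2 * (potential α (M.φ ti) - potential α y) with hG
  have hGc : Continuous G := by
    have := continuous_potential (α := α)
    fun_prop
  change (∫ y in M.φ t..M.φ ti, 1 / √(G y)) ≤ t - ti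
  have hf0 : ∀ y, 0 ≤ 1 / √(G y) := fun y => by positivity
  -- If the field ends no lower than it started, the oriented integral is nonpositive.
  rcases le_or_gt (M.φ ti) (M.φ t) with hle | hlt
  · rw [intervalIntegral.integral_symm]
    have := intervalIntegral.integral_nonneg_of_forall (μ := MeasureTheory.volume) hle hf0
    linarith
  have hcont : ContinuousOn M.φ (Icc ti t) := fun s hs =>
    (M.hasDerivAt_φ (hJ hs)).continuousAt.continuousWithinAt
  have hcomp : IsCompact (Icc ti t ∩ M.φ ⁻¹' Ici (M.φ ti)) :=
    isCompact_Icc.of_isClosed_subset (hcont.preimage_isClosed_of_isClosed isClosed_Icc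
      isClosed_Ici) inter_subset_left
  -- The field may first climb. After the last time `s₀` at which it is at least `M.φ ti` it stays
  -- strictly below, where G is positive.
  obtain ⟨s₀, ⟨hs₀, hφ₀⟩, hmax⟩ := hcomp.exists_isGreatest
    ⟨ti, left_mem_Icc.2 htt.le, le_refl (M.φ ti)⟩
  have hs₀t : s₀ < t := lt_of_le_of_ne hs₀.2 (by rintro rfl; exact absurd hφ₀ (not_le.2 hlt))
  have hbelow : ∀ s ∈ Ioc s₀ t, M.φ s < M.φ ti := by
    intro s hs
    by_contra hge
    exact absurd (hmax ⟨⟨hs₀.1.trans hs.1.le, hs.2⟩, not_lt.1 hge⟩) (not_le.2 hs.1)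
  have hGpos : ∀ y ∈ Ioo 0 (M.φ ti), 0 < G y := fun y hy => by
    have := potential_strictMono hα hy.1.le hy.2
    have := sq_nonneg (deriv M.φ ti)
    simp only [hG]
    linarith
  have hfc : ContinuousOn (fun y => 1 / √(G y)) (Ioo 0 (M.φ ti)) :=
    continuousOn_const.div hGc.sqrt.continuousOn fun y hy => (Real.sqrt_pos.2 (hGpos y hy)).ne'
  set F : ℝ → ℝ := fun x => ∫ y in M.φ t..x, 1 / √(G y) with hF
  have hmemt : M.φ t ∈ Ioo 0 (M.φ ti) := ⟨hφ t (right_mem_Icc.2 htt.le), hlt⟩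
  have hFd : ∀ x ∈ Ioo 0 (M.φ ti), HasDerivAt F (1 / √(G x)) x := fun x hx =>
    intervalIntegral.integral_hasDerivAt_right
      (hfc.mono (ordConnected_Ioo.uIcc_subset hmemt hx)).intervalIntegrable
      (hfc.stronglyMeasurableAtFilter isOpen_Ioo x hx)
      (hfc.continuousAt (isOpen_Ioo.mem_nhds hx))
  have hclaim : ∀ s₁ ∈ Ioc s₀ t, F (M.φ s₁) ≤ t - ti := by
    intro s₁ hs₁
    have hsub : ∀ s ∈ Icc s₁ t, s ∈ Ioc s₀ t ∧ s ∈ Icc ti t := fun s hs =>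
      ⟨⟨hs₁.1.trans_le hs.1, hs.2⟩, (hs₀.1.trans hs₁.1.le).trans hs.1, hs.2⟩
    have key := le_of_hasDerivAt_nonpos hs₁.2 (f := fun s => -F (M.φ s) - s)
      (fun s hs => ((hFd (M.φ s) ⟨hφ s (hsub s hs).2, hbelow s (hsub s hs).1⟩).comp s
        (M.hasDerivAt_φ (hJ (hsub s hs).2))).neg.sub (hasDerivAt_id s)) fun s hs => by
        have hpos := hGpos (M.φ s) ⟨hφ s (hsub s hs).2, hbelow s (hsub s hs).1⟩
        have hE := E_le hti ht hK s (hsub s hs).2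
        have hsq : deriv M.φ s ^ 2 ≤ G (M.φ s) := by
          rw [E, E] at hE
          simp only [hG]
          linarith
        have h1 : -√(G (M.φ s)) ≤ deriv M.φ s := (Real.abs_le_sqrt hsq |> abs_le.1).1
        have h2 := Real.sqrt_pos.2 hpos
        have h3 : -1 ≤ 1 / √(G (M.φ s)) * deriv M.φ s := by
          rw [one_div_mul_eq_div, le_div_iff₀ h2]
          linarith
        linarith
    have h0 : F (M.φ t) = 0 := intervalIntegral.integral_same
    simp only [h0] at key
    linarith [hs₁.1, hs₀.1]
  have hclaim' : ∀ x ∈ Ico (M.φ t) (M.φ ti), F x ≤ t - ti := by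
    intro x hx
    obtain ⟨s₁, hs₁, rfl⟩ := intermediate_value_Icc' hs₀t.le
      (hcont.mono (Icc_subset_Icc_left hs₀.1)) ⟨hx.1, hx.2.le.trans hφ₀⟩
    refine hclaim s₁ ⟨lt_of_le_of_ne hs₁.1 ?_, hs₁.2⟩
    rintro rfl
    exact absurd hφ₀ (not_le.2 hx.2)
  -- The bound on the descent times also shows that the improper integral converges.
  have hint : IntervalIntegrable (fun y => 1 / √(G y)) MeasureTheory.volume (M.φ t) (M.φ ti) := by
    rw [intervalIntegrable_iff_integrableOn_Ioc_of_le hlt.le]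
    set b : ℕ → ℝ := fun i => M.φ ti - (M.φ ti - M.φ t) * (1 / ((i : ℝ) + 1))
    have hb : ∀ i, b i ∈ Ico (M.φ t) (M.φ ti) := by
      intro i
      have h1 : 1 / ((i : ℝ) + 1) ≤ 1 := by
        rw [div_le_one (by positivity)]
        linarith [(Nat.cast_nonneg i : (0 : ℝ) ≤ i)]
      have h2 : 0 < 1 / ((i : ℝ) + 1) := by positivity
      constructor
      · nlinarith
      · have := mul_pos (sub_pos.2 hlt) h2
        simp only [b]
        linarith
    have hblim : Tendsto b atTop (𝓝 (M.φ ti)) := by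
      simpa [b] using ((tendsto_one_div_add_atTop_nhds_zero_nat (𝕜 := ℝ)).const_mul
        (M.φ ti - M.φ t)).const_sub (M.φ ti)
    refine MeasureTheory.integrableOn_Ioc_of_intervalIntegral_norm_bounded_right (I := t - ti)
      (fun i => ?_) hblim (Eventually.of_forall fun i => ?_)
    · rw [← intervalIntegrable_iff_integrableOn_Ioc_of_le (hb i).1]
      exact (hfc.mono (ordConnected_Ioo.uIcc_subset hmemt
        ⟨hmemt.1.trans_le (hb i).1, (hb i).2⟩)).intervalIntegrable
    · rw [← intervalIntegral.integral_of_le (hb i).1]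
      simpa only [Real.norm_of_nonneg (hf0 _)] using hclaim' (b i) (hb i)
  have hFc : ContinuousWithinAt F (Icc (M.φ t) (M.φ ti)) (M.φ ti) := by
    have := intervalIntegral.continuousOn_primitive_interval' hint left_mem_uIcc
    rw [uIcc_of_le hlt.le] at this
    exact this (M.φ ti) (right_mem_Icc.2 hlt.le)
  have hlim : Tendsto F (𝓝[<] M.φ ti) (𝓝 (F (M.φ ti))) :=
    hFc.tendsto.mono_left (nhdsWithin_le_of_mem (Icc_mem_nhdsLT hlt))
  exact le_of_tendsto hlim (by filter_upwards [Ico_mem_nhdsLT hlt] with x hx using hclaim' x hx)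

/-- The scalar field cannot roll down faster than with the constant force `-2 V_∞`. -/
theorem φ_ge (hα : 0 < α) {b : ℝ} (hti : ti ∈ M.J) (ht : t ∈ M.J) (htt : ti ≤ t)
    (hφ : ∀ s ∈ Icc ti t, 0 < M.φ s) (hK : ∀ s ∈ Icc ti t, 0 ≤ M.K s) (hb : 0 ≤ b)
    (hbi : -b ≤ deriv M.φ ti) :
    M.φ ti - b * (t - ti) - Vinf α * (t - ti) ^ 2 ≤ M.φ t := by
  have hJ := M.Icc_subset_J hti ht
  have hV := Vinf_pos hα
  have hvel : ∀ s ∈ Icc ti t, -(b + 2 * Vinf α * (s - ti)) ≤ deriv M.φ s := by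
    intro s hs
    have hmem : ∀ u ∈ Icc ti s, u ∈ Icc ti t := fun u hu => ⟨hu.1, hu.2.trans hs.2⟩
    -- The deficit f = -(φ' + b + 2 V_∞ (u - ti)) satisfies f' ≤ -K f: the force is at most 2 V_∞,
    -- and friction acts on a nonnegative speed bound.
    have key := nonpos_of_hasDerivAt_le hs.1
      (f := fun u => -(deriv M.φ u + (b + 2 * Vinf α * (u - ti)))) (c := fun u => -M.K u)
      (fun u hu => ((M.hasDerivAt_deriv_φ (hJ (hmem u hu))).add
        ((((hasDerivAt_id u).sub_const ti).const_mul (2 * Vinf α)).const_add b)).neg)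
      ((continuousOn_K hti ht).mono (Icc_subset_Icc_right hs.2)).neg (fun u hu => by
        have h1 := deriv_potential_le hα (hφ u (hmem u hu))
        have h2 := hK u (hmem u hu)
        have h3 : 0 ≤ 2 * Vinf α * (u - ti) := mul_nonneg (by linarith) (sub_nonneg.2 hu.1)
        nlinarith [mul_nonneg h2 (add_nonneg hb h3)]) (by simp; linarith)
    linarith
  have key := le_of_hasDerivAt_nonpos htt
    (f := fun s => -(M.φ s + (b * (s - ti) + Vinf α * (s - ti) ^ 2)))
    (fun s hs => ((M.hasDerivAt_φ (hJ hs)).add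
      ((((hasDerivAt_id s).sub_const ti).const_mul b).add
        ((((hasDerivAt_id s).sub_const ti).pow 2).const_mul (Vinf α)))).neg) fun s hs => by
      have := hvel s hs
      simp only [id]
      push_cast
      nlinarith
  simp only [sub_self] at key
  linarith

end BianchiModel

/-! ### Persistence of the expansion, outside type IX and in type IX -/

namespace BianchiModel

variable {α : ℝ} {𝔤 : Type*} [LieRing 𝔤] [LieAlgebra ℝ 𝔤] {e : Module.Basis (Fin 3) ℝ 𝔤}
  {M : BianchiModel α e} {η ti t : ℝ}

theorem R3_nonpos (hIX : ¬ IsTypeIX 𝔤) (ht : t ∈ M.J) : M.R3 t ≤ 0 :=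
  spatialCurvature_nonpos hIX e (M.posDef_h t ht)

theorem S_nonneg (hIX : ¬ IsTypeIX 𝔤) (ht : t ∈ M.J) : 0 ≤ M.S t := by
  rw [M.S_eq ht]
  linarith [M.σsq_nonneg ht, M.ρ_nonneg ht, R3_nonpos hIX ht]

theorem three_le_K_sq (hIX : ¬ IsTypeIX 𝔤) (ht : t ∈ M.J) (hV : η * Vinf α ≤ potential α (M.φ t)) :
    3 * η * Vinf α ≤ M.K t ^ 2 := by
  rw [K_sq]
  linarith [S_nonneg hIX ht, M.potential_le_E t]

theorem K_pos (hIX : ¬ IsTypeIX 𝔤) (hα : 0 < α) (hη : 0 < η) (hti : ti ∈ M.J) (ht : t ∈ M.J)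
    (hK : 0 < M.K ti) (hinf : M.Inflating η ti t) : ∀ s ∈ Icc ti t, 0 < M.K s := by
  refine pos_of_forall_ne_zero (continuousOn_K hti ht) hK fun s hs _ h0 => ?_
  have h1 := three_le_K_sq hIX (M.Icc_subset_J hti ht hs) (hinf s hs)
  rw [h0] at h1
  have : 0 < η * Vinf α := mul_pos hη (Vinf_pos hα)
  linarith

/-- For R ≤ 0 the Hamiltonian constraint has only nonnegative terms, so a bound on S bounds them
all. -/
theorem matter_eq_S (hIX : ¬ IsTypeIX 𝔤) (ht : t ∈ M.J) :
    M.σsq t + M.ρ t + |M.R3 t| / 2 = M.S t := by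
  rw [M.S_eq ht, abs_of_nonpos (R3_nonpos hIX ht)]
  ring

theorem rate_le (hα : 0 < α) (hη : 0 < η) (hη1 : η < 1) (hτ : 1 / √(Vinf α) ≤ t - ti) :
    3 * rate α η ^ 2 / sinh (rate α η * (t - ti)) ^ 2
      ≤ 9 * Vinf α * exp (-(2 * rate α η * (t - ti))) :=
  rate_bound hη hη1.le (Vinf_pos hα) hτ

theorem R3_le_R3max (ht : t ∈ M.J) : M.R3 t ≤ M.R3max t :=
  spatialCurvature_le_max e (M.posDef_h t ht)

theorem R3max_pos (hIX : IsTypeIX 𝔤) (ht : t ∈ M.J) : 0 < M.R3max t :=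
  spatialCurvatureMax_pos hIX e (M.posDef_h t ht)

theorem neg_half_R3max_le_S (ht : t ∈ M.J) : -(1 / 2) * M.R3max t ≤ M.S t := by
  rw [M.S_eq ht]
  linarith [M.σsq_nonneg ht, M.ρ_nonneg ht, R3_le_R3max ht]

/-- Used with a = η V_∞, r the initial maximal curvature and x its remaining fraction. The claim is
affine in r: at r = a it reads a(1 - x)/2 ≥ 0, and at r = (9/4) a it is a multiple of the cubic
`h3`. -/
theorem cubic_bound {a r x : ℝ} (h1 : a ≤ r) (h2 : r ≤ 9 / 4 * a) (hx0 : 0 ≤ x)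
    (hx1 : x ≤ 1) : 1 / 2 * (r * x) - a / 2 ≤ (r - a) * x ^ 3 := by
  have h3 : 0 ≤ 5 / 4 * x ^ 3 - 9 / 8 * x + 1 / 2 := by
    -- 0.55 is close to the minimizer √0.3 of the cubic, and 1.1 = 2 · 0.55 removes the quadratic
    -- term from the product.
    nlinarith [mul_nonneg (add_nonneg hx0 (show (0 : ℝ) ≤ 1.1 by norm_num)) (sq_nonneg (x - 0.55))]
  nlinarith [mul_nonneg (sub_nonneg.2 h2) (sub_nonneg.2 hx1), mul_nonneg (sub_nonneg.2 h1) h3]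

theorem R3max_le (hIX : IsTypeIX 𝔤) (hti : ti ∈ M.J) (ht : t ∈ M.J) (htt : ti ≤ t)
    (hK : ∀ s ∈ Icc ti t, 0 ≤ M.K s) : M.R3max t ≤ M.R3max ti :=
  le_of_hasDerivAt_nonpos htt (fun s hs => M.hasDerivAt_R3max (M.Icc_subset_J hti ht hs))
    fun s hs => by
      have := mul_nonneg (hK s hs) (R3max_pos hIX (M.Icc_subset_J hti ht hs)).le
      linarith

/-- Recollapse is prevented: the energy of the scalar field dominates the spatial curvature. -/
theorem half_le_E_sub_R3max (hIX : IsTypeIX 𝔤) (hα : 0 < α) (hη : 4 / 9 ≤ η) (hti : ti ∈ M.J)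
    (ht : t ∈ M.J) (htt : ti ≤ t) (hφ : 0 < M.φ ti) (hR : M.R3max ti < potential α (M.φ ti))
    (hinf : M.Inflating η ti t) (hK : ∀ s ∈ Icc ti t, 0 ≤ M.K s) :
    η * Vinf α / 2 ≤ M.E t - M.R3max t / 2 := by
  have hV := Vinf_pos hα
  have hJ := M.Icc_subset_J hti ht
  have hr := R3max_pos hIX ht
  have hri := R3max_pos hIX hti
  have hle := R3max_le hIX hti ht htt hK
  have hEt := (hinf t (right_mem_Icc.2 htt)).trans (M.potential_le_E t)
  set a := η * Vinf α with ha
  -- If the initial curvature is at most a, then E ≥ a and R_max ≤ a suffice.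
  rcases le_or_gt (M.R3max ti) a with h1 | h1
  · linarith
  -- The quotient (E - a)/R_max³ is nondecreasing: E' = -2K(E - V) ≥ -2K(E - a) because V ≥ a, while
  -- (R_max³)' = -2K R_max³.
  have hmono := le_of_hasDerivAt_nonpos htt (f := fun s => -((M.E s - a) / M.R3max s ^ 3))
    (fun s hs => ((((M.hasDerivAt_E (hJ hs)).sub_const a).div
      ((M.hasDerivAt_R3max (hJ hs)).pow 3)
      (pow_ne_zero 3 (R3max_pos hIX (hJ hs)).ne'))).neg) fun s hs => by
      have hrs := R3max_pos hIX (hJ hs)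
      have h2 := hinf s hs
      have h3 : 0 ≤ M.K s * (potential α (M.φ s) - a) := mul_nonneg (hK s hs) (sub_nonneg.2 h2)
      have h4 : M.E s = 1 / 2 * deriv M.φ s ^ 2 + potential α (M.φ s) := rfl
      rw [neg_nonpos]
      refine div_nonneg ?_ (by positivity)
      simp only [Pi.pow_apply]
      rw [h4]
      push_cast
      have h5 := mul_nonneg h3 (pow_nonneg hrs.le 3)
      nlinarith
  have h2 : M.R3max ti - a ≤ M.E ti - a := by linarith [M.potential_le_E ti]
  have hx0 : 0 ≤ M.R3max t / M.R3max ti := by positivity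
  have hx1 : M.R3max t / M.R3max ti ≤ 1 := (div_le_one hri).2 hle
  have h3 : (M.R3max ti - a) * (M.R3max t / M.R3max ti) ^ 3 ≤ M.E t - a := by
    have h4 : (M.E ti - a) / M.R3max ti ^ 3 ≤ (M.E t - a) / M.R3max t ^ 3 := by linarith
    rw [le_div_iff₀ (by positivity)] at h4
    calc (M.R3max ti - a) * (M.R3max t / M.R3max ti) ^ 3
        ≤ (M.E ti - a) * (M.R3max t / M.R3max ti) ^ 3 :=
          mul_le_mul_of_nonneg_right h2 (by positivity)
      _ = (M.E ti - a) / M.R3max ti ^ 3 * M.R3max t ^ 3 := by rw [div_pow]; ring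
      _ ≤ _ := h4
  -- This is where η ≥ 4/9 is needed: R_max(t_i) < V < V_∞ ≤ (9/4) η V_∞.
  have h4 : M.R3max ti ≤ 9 / 4 * a := by
    have := potential_lt_Vinf hα hφ
    nlinarith
  have h5 := cubic_bound h1.le h4 hx0 hx1
  rw [mul_div_cancel₀ _ hri.ne'] at h5
  linarith

theorem K_sq_ge_typeIX (hIX : IsTypeIX 𝔤) (hα : 0 < α) (hη : 4 / 9 ≤ η) (hti : ti ∈ M.J)
    (ht : t ∈ M.J) (htt : ti ≤ t) (hφ : 0 < M.φ ti) (hR : M.R3max ti < potential α (M.φ ti))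
    (hinf : M.Inflating η ti t) (hK : ∀ s ∈ Icc ti t, 0 ≤ M.K s) :
    3 / 2 * (η * Vinf α) ≤ M.K t ^ 2 := by
  have h1 := half_le_E_sub_R3max hIX hα hη hti ht htt hφ hR hinf hK
  have h2 := neg_half_R3max_le_S ht
  rw [K_sq]
  linarith

/-- A continuity argument: up to a first zero K is nonnegative, which is all the recollapse estimate
requires, and that estimate keeps K² away from 0. -/
theorem K_pos_typeIX (hIX : IsTypeIX 𝔤) (hα : 0 < α) (hη : 4 / 9 ≤ η) (hti : ti ∈ M.J)
    (ht : t ∈ M.J) (hKi : 0 < M.K ti) (hφ : 0 < M.φ ti)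
    (hR : M.R3max ti < potential α (M.φ ti)) (hinf : M.Inflating η ti t) :
    ∀ s ∈ Icc ti t, 0 < M.K s := by
  refine pos_of_forall_ne_zero (continuousOn_K hti ht) hKi fun s hs hnn h0 => ?_
  have h1 := K_sq_ge_typeIX hIX hα hη hti (M.Icc_subset_J hti ht hs) hs.1 hφ hR
    (hinf.mono hs.2) hnn
  rw [h0] at h1
  have : 0 < η * Vinf α := mul_pos (by linarith) (Vinf_pos hα)
  linarith

theorem R3max_le_exp (hIX : IsTypeIX 𝔤) (hα : 0 < α) (hη : 4 / 9 ≤ η) (hti : ti ∈ M.J)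
    (ht : t ∈ M.J) (htt : ti ≤ t) (hφ : 0 < M.φ ti) (hR : M.R3max ti < potential α (M.φ ti))
    (hinf : M.Inflating η ti t) (hK : ∀ s ∈ Icc ti t, 0 < M.K s) :
    M.R3max t ≤ M.R3max ti * exp (-(√(2 / 3 * η * Vinf α) * (t - ti))) := by
  have hV := Vinf_pos hα
  have hJ := M.Icc_subset_J hti ht
  have hl2 : √(2 / 3 * η * Vinf α) ^ 2 = 2 / 3 * η * Vinf α := Real.sq_sqrt (by positivity)
  have hl0 := Real.sqrt_nonneg (2 / 3 * η * Vinf α)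
  set l := √(2 / 3 * η * Vinf α)
  have key := le_of_hasDerivAt_nonpos htt (f := fun s => M.R3max s * exp (l * (s - ti)))
    (fun s hs => (M.hasDerivAt_R3max (hJ hs)).mul
      (((hasDerivAt_id s).sub_const ti).const_mul l).exp) fun s hs => by
      have h1 := K_sq_ge_typeIX hIX hα hη hti (hJ hs) hs.1 hφ hR (hinf.mono hs.2)
        fun u hu => (hK u ⟨hu.1, hu.2.trans hs.2⟩).le
      -- (3l/2)² = (3/2) η V_∞, the lower bound on K²; the decay rate (2/3) K is then at least l.
      have h2 : 3 / 2 * l ≤ M.K s :=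
        (pow_le_pow_iff_left₀ (by positivity) (hK s hs).le two_ne_zero).1 (by nlinarith)
      have h3 := mul_pos (R3max_pos hIX (hJ hs)) (exp_pos (l * (s - ti)))
      simp only [id]
      nlinarith
  simp only [sub_self, mul_zero, exp_zero, mul_one] at key
  rw [exp_neg, ← div_eq_mul_inv, le_div_iff₀ (exp_pos _)]
  exact key

end BianchiModel

/-! ### The no-hair estimates and the duration of inflation -/

open BianchiModel

theorem noHair_of_not_typeIX {α η : ℝ} {𝔤 : Type*} [LieRing 𝔤] [LieAlgebra ℝ 𝔤]
    {e : Module.Basis (Fin 3) ℝ 𝔤} {M : BianchiModel α e} {ti t : ℝ} (hα : 0 < α) (hη : 0 < η)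
    (hη1 : η < 1) (hIX : ¬ IsTypeIX 𝔤) (hti : ti ∈ M.J) (ht : t ∈ M.J) (htt : ti < t)
    (hK : 0 < M.K ti) (hφ : 0 < M.φ ti) (hinf : M.Inflating η ti t) :
    0 ≤ M.S t ∧
    M.S t ≤ 3 * rate α η ^ 2 / Real.sinh (rate α η * (t - ti)) ^ 2 ∧
    0 ≤ M.σsq t ∧ 0 ≤ M.ρ t ∧ M.R3 t ≤ 0 ∧
    M.σsq t + M.ρ t + |M.R3 t| / 2
      ≤ 3 * rate α η ^ 2 / Real.sinh (rate α η * (t - ti)) ^ 2 ∧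
    √(3 * η * Vinf α) ≤ M.K t ∧
    M.K t ≤ √(3 * Vinf α) / Real.tanh (√(Vinf α / 3) * (t - ti)) ∧
    (1 / √(Vinf α) ≤ t - ti →
      M.σsq t + M.ρ t + |M.R3 t| / 2
        ≤ 9 * Vinf α * Real.exp (-(2 * rate α η * (t - ti)))) ∧
    M.undampedTime ti (M.φ t) ≤ t - ti := by
  have hKs := K_pos hIX hα hη hti ht hK hinf
  have hφs := hinf.φ_pos hα hη hti ht hφ
  have hS := S_le hα hη hti ht htt hinf hKs
  refine ⟨S_nonneg hIX ht, hS, M.σsq_nonneg ht, M.ρ_nonneg ht, R3_nonpos hIX ht,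
    (matter_eq_S hIX ht).trans_le hS, ?_, expansion_le hα hti ht htt hφs,
    fun hτ => ((matter_eq_S hIX ht).trans_le hS).trans (rate_le hα hη hη1 hτ),
    undampedTime_le hα hti ht htt hφs fun s hs => (hKs s hs).le⟩
  have hmem := right_mem_Icc.2 htt.le
  exact Real.sqrt_le_iff.2 ⟨(hKs t hmem).le, three_le_K_sq hIX ht (hinf t hmem)⟩

theorem noHair_of_typeIX {α η : ℝ} {𝔤 : Type*} [LieRing 𝔤] [LieAlgebra ℝ 𝔤]
    {e : Module.Basis (Fin 3) ℝ 𝔤} {M : BianchiModel α e} {ti t : ℝ} (hα : 0 < α) (hη : 4 / 9 ≤ η)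
    (hη1 : η < 1) (hIX : IsTypeIX 𝔤) (hti : ti ∈ M.J) (ht : t ∈ M.J) (htt : ti < t)
    (hK : 0 < M.K ti) (hφ : 0 < M.φ ti) (hR : M.R3max ti < potential α (M.φ ti))
    (hinf : M.Inflating η ti t) :
    -(1 / 2) * M.R3max ti * Real.exp (-(√(2 / 3 * η * Vinf α) * (t - ti))) ≤ M.S t ∧
    M.S t ≤ max 0 (3 * rate α η ^ 2 / Real.sinh (rate α η * (t - ti)) ^ 2) ∧
    -2 * M.S t ≤ M.R3 t ∧ M.R3 t ≤ M.R3max t ∧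
    M.R3max t ≤ M.R3max ti * Real.exp (-(√(2 / 3 * η * Vinf α) * (t - ti))) ∧
    0 ≤ M.σsq t ∧ 0 ≤ M.ρ t ∧
    M.σsq t + M.ρ t + |M.R3 t| / 2
      ≤ 3 * rate α η ^ 2 / Real.sinh (rate α η * (t - ti)) ^ 2
        + M.R3max ti * Real.exp (-(√(2 / 3 * η * Vinf α) * (t - ti))) ∧
    0 < M.K t ∧
    3 * (η * Vinf α
      - 1 / 2 * M.R3max ti * Real.exp (-(√(2 / 3 * η * Vinf α) * (t - ti)))) ≤ M.K t ^ 2 ∧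
    M.K t ≤ √(3 * Vinf α) / Real.tanh (√(Vinf α / 3) * (t - ti)) ∧
    (1 / √(Vinf α) ≤ t - ti →
      M.σsq t + M.ρ t + |M.R3 t| / 2
        ≤ 10 * Vinf α * Real.exp (-(√(2 / 3 * η * Vinf α) * (t - ti)))) ∧
    M.undampedTime ti (M.φ t) ≤ t - ti := by
  have hη0 : 0 < η := by linarith
  have hV := Vinf_pos hα
  have hKs := K_pos_typeIX hIX hα hη hti ht hK hφ hR hinf
  have hφs := hinf.φ_pos hα hη0 hti ht hφ
  have hS := S_le hα hη0 hti ht htt hinf hKs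
  have hmem := right_mem_Icc.2 htt.le
  have hr := R3max_le_exp hIX hα hη hti ht htt.le hφ hR hinf hKs
  have hSr := neg_half_R3max_le_S ht
  have hσ := M.σsq_nonneg ht
  have hρ := M.ρ_nonneg ht
  have hSe := M.S_eq ht
  have hRr := R3_le_R3max ht
  have hrpos := R3max_pos hIX ht
  have hVE := (hinf t hmem).trans (M.potential_le_E t)
  have hrate := rate_le (t := t) (ti := ti) hα hη0 hη1
  have hB : 0 ≤ 3 * rate α η ^ 2 / Real.sinh (rate α η * (t - ti)) ^ 2 := by positivity
  have hmatter : M.σsq t + M.ρ t + |M.R3 t| / 2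
      ≤ 3 * rate α η ^ 2 / Real.sinh (rate α η * (t - ti)) ^ 2
        + M.R3max ti * Real.exp (-(√(2 / 3 * η * Vinf α) * (t - ti))) := by
    -- For R < 0 the left side equals S; otherwise it equals S + R, and R ≤ R_max.
    rcases abs_cases (M.R3 t) with ⟨h1, h2⟩ | ⟨h1, h2⟩ <;> rw [h1] <;> linarith
  refine ⟨by linarith, hS.trans (le_max_right _ _), by linarith, hRr, hr, hσ, hρ, hmatter,
    hKs t hmem, ?_, expansion_le hα hti ht htt hφs, fun hτ => ?_,
    undampedTime_le hα hti ht htt hφs fun s hs => (hKs s hs).le⟩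
  · rw [K_sq]
    linarith
  · have h1 := hrate hτ
    have h2 : √(2 / 3 * η * Vinf α) ≤ 2 * rate α η := by
      rw [rate, show (2 : ℝ) * √(η * Vinf α / 3) = √(2 ^ 2 * (η * Vinf α / 3)) by
        rw [Real.sqrt_mul (by norm_num), Real.sqrt_sq (by norm_num)]]
      apply Real.sqrt_le_sqrt
      have : 0 < η * Vinf α := by positivity
      linarith
    have h3 : exp (-(2 * rate α η * (t - ti))) ≤ exp (-(√(2 / 3 * η * Vinf α) * (t - ti))) := by
      apply exp_le_exp.2
      have := mul_le_mul_of_nonneg_right h2 (sub_pos.2 htt).le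
      linarith
    have h4 : M.R3max ti ≤ Vinf α := (hR.trans (potential_lt_Vinf hα hφ)).le
    have h5 := mul_le_mul_of_nonneg_right h4 (exp_pos (-(√(2 / 3 * η * Vinf α) * (t - ti)))).le
    nlinarith

/-- The ratio V/V_∞ does not depend on α, so one threshold, found at α = 1/8 where V_∞ = 1, serves
every α. -/
theorem exists_plateau {η : ℝ} (hη : η < 1) :
    ∃ Y : ℝ, 0 < Y ∧ ∀ α, 0 < α → ∀ y, Y ≤ y → η * Vinf α < potential α y := by
  have h1 : Tendsto (potential (1 / 8)) atTop (𝓝 1) := by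
    simpa [Vinf] using tendsto_potential (1 / 8)
  obtain ⟨Y, hY⟩ := eventually_atTop.1 (h1.eventually_const_lt hη)
  refine ⟨max Y 1, by positivity, fun α hα y hy => ?_⟩
  have h2 := hY y ((le_max_left _ _).trans hy)
  rw [potential_eq, show Vinf (1 / 8) = 1 by norm_num [Vinf], one_mul] at h2
  rw [potential_eq, mul_comm]
  exact mul_lt_mul_of_pos_left h2 (Vinf_pos hα)

/-- A model which starts far enough on the plateau stays there for any prescribed time. -/
theorem exists_forall_inflating {η : ℝ} (hη : 4 / 9 ≤ η) (hη1 : η < 1) {v N : ℝ} (hv : 0 ≤ v)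
    (hN : 0 < N) : ∃ φ₀ : ℝ, 0 < φ₀ ∧
      ∀ (α : ℝ) (𝔤 : Type*) [LieRing 𝔤] [LieAlgebra ℝ 𝔤] (e : Module.Basis (Fin 3) ℝ 𝔤)
        (M : BianchiModel α e) (ti t : ℝ),
      0 < α → (IsTypeIX 𝔤 → M.R3max ti < potential α (M.φ ti)) →
      ti ∈ M.J → t ∈ M.J → t ≤ ti + N / √(Vinf α) →
      0 < M.K ti → φ₀ ≤ M.φ ti → -(v * √(Vinf α)) ≤ deriv M.φ ti → M.Inflating η ti t := by
  obtain ⟨Y, hY0, hY⟩ := exists_plateau hη1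
  -- Within the time N/√V_∞ the initial speed costs at most vN, and the constant force at most V_∞
  -- τ² ≤ N².
  refine ⟨Y + v * N + N ^ 2, by positivity, ?_⟩
  intro α 𝔤 _ _ e M ti t hα hR hti ht htN hK hφ₀ hφ'
  have hV := Vinf_pos hα
  have hJ := M.Icc_subset_J hti ht
  have hη0 : 0 < η := by linarith
  have hYφ : Y ≤ M.φ ti := by nlinarith [mul_nonneg hv hN.le, sq_nonneg N]
  -- Until the potential first reaches η V_∞ the model is in the inflationary regime and expands, so
  -- the bound on the fall of φ applies and still leaves φ ≥ Y, where V is strictly above that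
  -- level.
  have key := pos_of_forall_ne_zero (a := ti) (b := t)
    (f := fun s => potential α (M.φ s) - η * Vinf α)
    (fun s hs => ((continuous_potential.continuousAt.comp
      (M.hasDerivAt_φ (hJ hs)).continuousAt).sub continuousAt_const).continuousWithinAt)
    (sub_pos.2 (hY α hα _ hYφ)) fun s hs hnn => by
      have hinf : M.Inflating η ti s := fun u hu => sub_nonneg.1 (hnn u hu)
      have hφi : 0 < M.φ ti := hY0.trans_le hYφ
      have hKs : ∀ u ∈ Icc ti s, 0 < M.K u := by
        by_cases hIX : IsTypeIX 𝔤
        · exact K_pos_typeIX hIX hα hη hti (hJ hs) hK hφi (hR hIX) hinf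
        · exact K_pos hIX hα hη0 hti (hJ hs) hK hinf
      have h1 := φ_ge hα hti (hJ hs) hs.1 (hinf.φ_pos hα hη0 hti (hJ hs) hφi)
        (fun u hu => (hKs u hu).le) (mul_nonneg hv (Real.sqrt_nonneg _)) hφ'
      have hsV := Real.sqrt_pos.2 hV
      have h2 : √(Vinf α) * (s - ti) ≤ N := by
        have : s - ti ≤ N / √(Vinf α) := by linarith [hs.2]
        rw [le_div_iff₀ hsV] at this
        linarith
      have h3 : 0 ≤ √(Vinf α) * (s - ti) := mul_nonneg hsV.le (sub_nonneg.2 hs.1)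
      have h4 : Vinf α * (s - ti) ^ 2 ≤ N ^ 2 := by
        have h5 := pow_le_pow_left₀ h3 h2 2
        rwa [mul_pow, Real.sq_sqrt hV.le] at h5
      have h5 := mul_le_mul_of_nonneg_left h2 hv
      have h6 := hY α hα (M.φ s) (by linarith)
      exact (sub_pos.2 h6).ne'
  exact fun s hs => (sub_pos.1 (key s hs)).le

/-- For η ≥ 1/2 both decay rates, λ and 2m, are at least √(V_∞/3), so the bound depends on T alone.
-/
theorem isotropization {α η T : ℝ} {𝔤 : Type*} [LieRing 𝔤] [LieAlgebra ℝ 𝔤]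
    {e : Module.Basis (Fin 3) ℝ 𝔤} {M : BianchiModel α e} {ti t : ℝ} (hα : 0 < α)
    (hη : 1 / 2 ≤ η) (hη1 : η < 1) (hT : 1 ≤ T)
    (hR : IsTypeIX 𝔤 → M.R3max ti < potential α (M.φ ti)) (hti : ti ∈ M.J) (ht : t ∈ M.J)
    (hτ : ti + T / √(Vinf α) ≤ t) (hK : 0 < M.K ti) (hφ : 0 < M.φ ti)
    (hinf : M.Inflating η ti t) :
    M.σsq t + M.ρ t + |M.R3 t| / 2 ≤ 10 * exp (-(T / √3)) * Vinf α := by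
  have hV := Vinf_pos hα
  have hsV := Real.sqrt_pos.2 hV
  have hτ1 : 1 / √(Vinf α) ≤ t - ti :=
    (div_le_div_of_nonneg_right hT hsV.le).trans (by linarith)
  have htt : ti < t := by
    have : 0 < 1 / √(Vinf α) := by positivity
    linarith
  have hbound : ∀ l, √(Vinf α / 3) ≤ l → exp (-(l * (t - ti))) ≤ exp (-(T / √3)) := by
    intro l hl
    apply exp_le_exp.2
    have h1 : T / √3 = √(Vinf α / 3) * (T / √(Vinf α)) := by
      rw [Real.sqrt_div hV.le]
      field_simp
    have h2 := mul_le_mul hl (show T / √(Vinf α) ≤ t - ti by linarith) (by positivity)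
      ((Real.sqrt_nonneg _).trans hl)
    linarith
  by_cases hIX : IsTypeIX 𝔤
  · obtain ⟨-, -, -, -, -, -, -, -, -, -, -, h, -⟩ :=
      noHair_of_typeIX hα (by linarith) hη1 hIX hti ht htt hK hφ (hR hIX) hinf
    have h1 := hbound (√(2 / 3 * η * Vinf α)) (Real.sqrt_le_sqrt (by nlinarith))
    nlinarith [h hτ1]
  · obtain ⟨-, -, -, -, -, -, -, -, h, -⟩ :=
      noHair_of_not_typeIX hα (by linarith) hη1 hIX hti ht htt hK hφ hinf
    have h1 := hbound (2 * rate α η) (by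
      have h2 : √(Vinf α / 3 / 2) ≤ rate α η := Real.sqrt_le_sqrt (by nlinarith)
      rw [Real.sqrt_le_left (by unfold rate; positivity)]
      have h3 : rate α η ^ 2 = η * Vinf α / 3 := Real.sq_sqrt (by positivity)
      nlinarith)
    nlinarith [h hτ1, exp_pos (-(T / √3))]

end BianchiCosmology

end
open BianchiCosmology in
theorem mainTheorem1 :
    -- all Bianchi types except IX
    (∀ (α η : ℝ) (𝔤 : Type*) [LieRing 𝔤] [LieAlgebra ℝ 𝔤] (e : Module.Basis (Fin 3) ℝ 𝔤)
        (M : BianchiModel α e) (ti t : ℝ),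
      0 < α → 0 < η → η < 1 → ¬ IsTypeIX 𝔤 →
      ti ∈ M.J → t ∈ M.J → ti < t →
      0 < M.K ti → 0 < M.φ ti → M.Inflating η ti t →
        0 ≤ M.S t ∧
        M.S t ≤ 3 * rate α η ^ 2 / Real.sinh (rate α η * (t - ti)) ^ 2 ∧
        0 ≤ M.σsq t ∧ 0 ≤ M.ρ t ∧ M.R3 t ≤ 0 ∧
        M.σsq t + M.ρ t + |M.R3 t| / 2
          ≤ 3 * rate α η ^ 2 / Real.sinh (rate α η * (t - ti)) ^ 2 ∧
        √(3 * η * Vinf α) ≤ M.K t ∧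
        M.K t ≤ √(3 * Vinf α) / Real.tanh (√(Vinf α / 3) * (t - ti)) ∧
        (1 / √(Vinf α) ≤ t - ti →
          M.σsq t + M.ρ t + |M.R3 t| / 2
            ≤ 9 * Vinf α * Real.exp (-(2 * rate α η * (t - ti)))) ∧
        M.undampedTime ti (M.φ t) ≤ t - ti) ∧
    -- Bianchi type IX
    (∀ (α η : ℝ) (𝔤 : Type*) [LieRing 𝔤] [LieAlgebra ℝ 𝔤] (e : Module.Basis (Fin 3) ℝ 𝔤)
        (M : BianchiModel α e) (ti t : ℝ),
      0 < α → 4 / 9 ≤ η → η < 1 → IsTypeIX 𝔤 →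
      ti ∈ M.J → t ∈ M.J → ti < t →
      0 < M.K ti → 0 < M.φ ti → M.R3max ti < potential α (M.φ ti) → M.Inflating η ti t →
        -(1 / 2) * M.R3max ti * Real.exp (-(√(2 / 3 * η * Vinf α) * (t - ti))) ≤ M.S t ∧
        M.S t ≤ max 0 (3 * rate α η ^ 2 / Real.sinh (rate α η * (t - ti)) ^ 2) ∧
        -2 * M.S t ≤ M.R3 t ∧ M.R3 t ≤ M.R3max t ∧
        M.R3max t ≤ M.R3max ti * Real.exp (-(√(2 / 3 * η * Vinf α) * (t - ti))) ∧
        0 ≤ M.σsq t ∧ 0 ≤ M.ρ t ∧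
        M.σsq t + M.ρ t + |M.R3 t| / 2
          ≤ 3 * rate α η ^ 2 / Real.sinh (rate α η * (t - ti)) ^ 2
            + M.R3max ti * Real.exp (-(√(2 / 3 * η * Vinf α) * (t - ti))) ∧
        0 < M.K t ∧
        3 * (η * Vinf α
          - 1 / 2 * M.R3max ti * Real.exp (-(√(2 / 3 * η * Vinf α) * (t - ti)))) ≤ M.K t ^ 2 ∧
        M.K t ≤ √(3 * Vinf α) / Real.tanh (√(Vinf α / 3) * (t - ti)) ∧
        (1 / √(Vinf α) ≤ t - ti →
          M.σsq t + M.ρ t + |M.R3 t| / 2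
            ≤ 10 * Vinf α * Real.exp (-(√(2 / 3 * η * Vinf α) * (t - ti)))) ∧
        M.undampedTime ti (M.φ t) ≤ t - ti) ∧
    -- inflation outlasts isotropization by any prescribed factor
    (∀ ε : ℝ, 0 < ε → ∃ T : ℝ, 0 < T ∧ ∀ η v N : ℝ, 0 < η → η < 1 → 0 ≤ v → 0 < N → ∃ φ₀ : ℝ,
      ∀ (α : ℝ) (𝔤 : Type*) [LieRing 𝔤] [LieAlgebra ℝ 𝔤] (e : Module.Basis (Fin 3) ℝ 𝔤)
        (M : BianchiModel α e) (ti t : ℝ),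
      0 < α → (IsTypeIX 𝔤 → M.R3max ti < potential α (M.φ ti)) →
      ti ∈ M.J → t ∈ M.J → ti ≤ t → t ≤ ti + N / √(Vinf α) →
      0 < M.K ti → φ₀ ≤ M.φ ti → -(v * √(Vinf α)) ≤ deriv M.φ ti →
        η * Vinf α ≤ potential α (M.φ t) ∧
        (ti + T / √(Vinf α) ≤ t →
          M.σsq t + M.ρ t + |M.R3 t| / 2 ≤ ε * Vinf α)) := by
  refine ⟨?_, ?_, ?_⟩
  · intro α η 𝔤 _ _ e M ti t hα hη hη1 hIX hti ht htt hK hφ hinf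
    exact noHair_of_not_typeIX hα hη hη1 hIX hti ht htt hK hφ hinf
  · intro α η 𝔤 _ _ e M ti t hα hη hη1 hIX hti ht htt hK hφ hR hinf
    exact noHair_of_typeIX hα hη hη1 hIX hti ht htt hK hφ hR hinf
  · intro ε hε
    -- T ≥ 1 is one Hubble time, and T ≥ √3 log(10/ε) makes 10 e^(-T/√3) ≤ ε.
    refine ⟨max 1 (√3 * Real.log (10 / ε)), by positivity, fun η v N hη hη1 hv hN => ?_⟩
    -- Raising η to at least 1/2 makes T independent of η and meets the type IX condition η ≥ 4/9.
    -- Only `φ₀`, which may depend on η, has to grow.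
    have hη' : max η (1 / 2) < 1 := max_lt hη1 (by norm_num)
    have hhalf : 1 / 2 ≤ max η (1 / 2) := le_max_right _ _
    obtain ⟨φ₀, hφ₀, key⟩ := exists_forall_inflating (by linarith) hη' hv hN
    refine ⟨φ₀, ?_⟩
    intro α 𝔤 _ _ e M ti t hα hR hti ht htt htN hK hφ hφ'
    have hinf := key α 𝔤 e M ti t hα hR hti ht htN hK hφ hφ'
    have hV := Vinf_pos hα
    refine ⟨?_, fun hτ => ?_⟩
    · exact (mul_le_mul_of_nonneg_right (le_max_left η (1 / 2)) hV.le).trans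
        (hinf t (right_mem_Icc.2 htt))
    · refine (isotropization hα hhalf hη' (le_max_left _ _) hR hti ht hτ hK
        (hφ₀.trans_le hφ) hinf).trans (mul_le_mul_of_nonneg_right ?_ hV.le)
      have h1 : Real.log (10 / ε) ≤ max 1 (√3 * Real.log (10 / ε)) / √3 := by
        rw [le_div_iff₀ (by positivity), mul_comm]
        exact le_max_right _ _
      have h2 : Real.exp (-(max 1 (√3 * Real.log (10 / ε)) / √3)) ≤ ε / 10 := by
        refine (Real.exp_le_exp.2 (neg_le_neg h1)).trans_eq ?_
        rw [Real.exp_neg, Real.exp_log (by positivity), inv_div]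
      linarith
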